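/- All graphs are finite, simple and have at least one vertex. The density of a graph is its number of edges divided by its number of vertices. A class $\mathcal A$ of graphs is minor-closed if every minor of a graph in $\mathcal A$ is in $\mathcal A$, and proper if it is non-empty and does not contain all graphs. The critical density $\beta_{\mathcal A}$ of a proper minor-closed class $\mathcal A$ is the supremum of the densities of the graphs in $\mathcal A$. An excluded minor for $\mathcal A$ is a graph that is not in $\mathcal A$ but all of whose proper minors are in $\mathcal A$. A graph is $2$-connected if it has at least three vertices, is connected, and remains connected after the deletion of any one vertex. Let $$B=\{\beta_{\mathcal A} : \mathcal A \text{ is a proper minor-closed class of graphs}\},$$ let $B'\subseteq\mathbb R$ be the set of accumulation points of $B$, let $1+B=\{1+\beta : \beta\in B\}$, and let $$B_2=\{\beta_{\mathcal A} : \mathcal A \text{ is a proper minor-closed class of graphs such that each excluded minor for } \mathcal A \text{ is } 2\text{-connected}\}$$ (the set of critical densities of addable proper minor-closed classes). Theorem 5. We have $1+B\subsetneq B_2\subseteq B'$; moreover $B_2\cap[0,1)=B'\cap[0,1)=\emptyset$, and $$(1+B)\cap[1,2]=B_2\cap[1,2]=B'\cap[1,2]=\left\{2-\frac1k : k\ge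 1,\ k\in\mathbb Z\right\}\cup\{2\}.$$ Furthermore, $\frac{25}{11}\in B_2\setminus(1+B)$. -/

import Mathlib

namespace CriticalDensity

/-- A finite simple graph with at least one vertex. -/
structure FinGraph : Type 1 where
  /-- the vertices -/
  V : Type
  [finite : Finite V]
  [nonempty : Nonempty V]
  /-- the adjacency structure -/
  graph : SimpleGraph V

attribute [instance] FinGraph.finite FinGraph.nonempty

/-- The number `v(G)` of vertices. -/
noncomputable def FinGraph.v (G : FinGraph) : ℕ := Nat.card G.V

/-- The number `e(G)` of edges. -/
noncomputable def FinGraph.e (G : FinGraph) : ℕ := G.graph.edgeSet.ncard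

/-- The density `ρ(G) = e(G) / v(G)`, the number of edges per vertex. -/
noncomputable def FinGraph.density (G : FinGraph) : ℝ := (G.e : ℝ) / (G.v : ℝ)

/-- Two graphs are isomorphic. -/
def FinGraph.Isomorphic (G H : FinGraph) : Prop := Nonempty (G.graph ≃g H.graph)

/-- `H` is a minor of `G`: there are pairwise disjoint (nonempty) connected branch sets in `G`, one
for each vertex of `H`, such that for every edge `xy` of `H` some edge of `G` joins the branch set
of `x` to that of `y`. Contracting the branch sets in a suitable subgraph of `G` gives `H`. -/
def IsMinor (H G : FinGraph) : Prop :=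
  ∃ W : H.V → Set G.V,
    (∀ x, (G.graph.induce (W x)).Connected) ∧
    (∀ x y, x ≠ y → Disjoint (W x) (W y)) ∧
    (∀ x y, H.graph.Adj x y → ∃ a ∈ W x, ∃ b ∈ W y, G.graph.Adj a b)

/-- A proper minor of `G` is a minor of `G` other than `G` itself, up to isomorphism. -/
def IsProperMinor (H G : FinGraph) : Prop := IsMinor H G ∧ ¬ H.Isomorphic G

/-- A class of graphs closed under taking minors (hence also under isomorphism). -/
def MinorClosed (𝒜 : Set FinGraph) : Prop :=
  ∀ G ∈ 𝒜, ∀ H, IsMinor H G → H ∈ 𝒜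

/-- A class of graphs is proper if it is nonempty and does not contain all graphs. -/
def ProperClass (𝒜 : Set FinGraph) : Prop := 𝒜.Nonempty ∧ 𝒜 ≠ Set.univ

/-- `G` is an excluded minor for `𝒜`: it is not in `𝒜`, but each of its proper minors is. -/
def IsExcludedMinor (𝒜 : Set FinGraph) (G : FinGraph) : Prop :=
  G ∉ 𝒜 ∧ ∀ H, IsProperMinor H G → H ∈ 𝒜

/-- `G` is `t`-connected: it has more than `t` vertices, and deleting fewer than `t` vertices never
disconnects it. -/
def FinGraph.IsTConnected (t : ℕ) (G : FinGraph) : Prop :=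
  t < G.v ∧ ∀ S : Set G.V, S.ncard < t → (G.graph.induce Sᶜ).Connected

/-- `β` is the critical density of `𝒜`, the (finite) supremum of the densities of its members. -/
def IsCriticalDensity (𝒜 : Set FinGraph) (β : ℝ) : Prop :=
  IsLUB (FinGraph.density '' 𝒜) β

/-- The set `B` of critical densities of proper minor-closed classes of graphs. -/
def B : Set ℝ :=
  {β | ∃ 𝒜 : Set FinGraph, ProperClass 𝒜 ∧ MinorClosed 𝒜 ∧ IsCriticalDensity 𝒜 β}

/-- The set `B_t` of critical densities of proper minor-closed classes of graphs all of whose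
excluded minors are `t`-connected. -/
def Bt (t : ℕ) : Set ℝ :=
  {β | ∃ 𝒜 : Set FinGraph, ProperClass 𝒜 ∧ MinorClosed 𝒜 ∧
    (∀ G, IsExcludedMinor 𝒜 G → G.IsTConnected t) ∧ IsCriticalDensity 𝒜 β}

/-- The set `1 + B = {1 + β : β ∈ B}`. -/
def onePlusB : Set ℝ := {x | ∃ β ∈ B, x = 1 + β}

/-- The set `{2 - 1/k : k ≥ 1} ∪ {2}`. -/
def lowValues : Set ℝ := {x | ∃ k : ℕ, 1 ≤ k ∧ x = 2 - 1 / (k : ℝ)} ∪ {2}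

end CriticalDensity

/-!
The class `sparseClass c` of graphs all of whose minors satisfy `e ≤ c (v - 1)` is minor-closed, and
its excluded minors are `2`-connected when `c ≥ 1`, because the bound passes from the two sides of a
cut vertex to the whole graph. Conversely, a minor-closed class with `2`-connected excluded minors
is closed under gluing copies of a graph at a vertex (`glue_mem`), as a `2`-connected minor of the
glued graph is already a minor of one copy. Gluing many copies shows that the graphs of such a class
satisfy `e ≤ β (v - 1)`, where `β` is the critical density. This has two consequences.

* `β` is not attained, so the critical densities of the classes of minors of single graphs of the
  class approach `β` from below, and `B₂ ⊆ B'` (`Bt_two_subset`).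
* `c ∈ B₂` as soon as graphs in `sparseClass c` have `e / (v - 1)` close to `c` (`mem_Bt_two`). For
  `c = 1 + β` these are the cones over the graphs of a class with critical density `β`, so
  `1 + B ⊆ B₂`. For `c = 25 / 11` it is the graph `diamondK4` with 12 vertices and 25 edges.

For the small values, let `H` be a graph that is denser than all its minors with fewer vertices, and
let its density `ρ` exceed `2 - 1 / k`. Contracting a connected set `S` must lose more than
`ρ (|S| - 1)` edges, and this allows one to build up `H` from a vertex by steps that add `t`
vertices and at least `(2 - 1 / (k + 1)) t` edges (`IsDensityMinimal.exists_superset`). Hence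
`e(H) ≥ (2 - 1 / (k + 1)) (v(H) - 1)`, so densities bounded away from `2 - 1 / (k + 1)` occur only
for boundedly many vertices, and `B` has no accumulation point strictly between `2 - 1 / k` and
`2 - 1 / (k + 1)`. For `k = 1` the same inequality shows that `14 / 11 ∉ B`, that is,
`25 / 11 ∉ 1 + B`. Finally `B ∩ [0, 1]` consists of `1` and the numbers `1 - 1 / k`, the critical
densities of the classes of forests of order at most `k`.
-/

namespace CriticalDensity

/-! ### Connected vertex sets -/

theorem const_of_connected {V α : Type*} {G : SimpleGraph V} {A : Set V}
    (hA : (G.induce A).Connected) (f : V → α)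
    (hf : ∀ a ∈ A, ∀ b ∈ A, G.Adj a b → f a = f b) {a b : V} (ha : a ∈ A) (hb : b ∈ A) :
    f a = f b := by
  have key : ∀ x y : A, (G.induce A).Reachable x y → f x = f y := by
    rintro x y ⟨w⟩
    induction w with
    | nil => rfl
    | cons h _ ih => exact (hf _ (Subtype.prop _) _ (Subtype.prop _) h).trans ih
  exact key ⟨a, ha⟩ ⟨b, hb⟩ (hA.preconnected _ _)

/-- A map that sends each edge inside a connected set to an edge or to a single vertex preserves
connectedness. -/
theorem connected_image {V V' : Type*} {G : SimpleGraph V} {G' : SimpleGraph V'} {A : Set V}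
    (hA : (G.induce A).Connected) (φ : V → V')
    (hφ : ∀ a ∈ A, ∀ b ∈ A, G.Adj a b → φ a = φ b ∨ G'.Adj (φ a) (φ b)) :
    (G'.induce (φ '' A)).Connected := by
  have key : ∀ x y : A, (G.induce A).Reachable x y →
      (G'.induce (φ '' A)).Reachable ⟨φ x, x, x.2, rfl⟩ ⟨φ y, y, y.2, rfl⟩ := by
    rintro x y ⟨w⟩
    induction w with
    | nil => exact SimpleGraph.Reachable.refl _
    | @cons u v w h _ ih =>
      refine SimpleGraph.Reachable.trans ?_ ih
      rcases hφ u u.2 v v.2 h with e | e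
      · have : (⟨φ u, u, u.2, rfl⟩ : φ '' A) = ⟨φ v, v, v.2, rfl⟩ := Subtype.ext e
        rw [this]
      · exact SimpleGraph.Adj.reachable (by simpa using e)
  obtain ⟨a⟩ := hA.nonempty
  have : Nonempty (φ '' A) := ⟨⟨φ a, a, a.2, rfl⟩⟩
  refine ⟨?_⟩
  rintro ⟨_, x, hx, rfl⟩ ⟨_, y, hy, rfl⟩
  exact key ⟨x, hx⟩ ⟨y, hy⟩ (hA.preconnected _ _)

/-- A union of connected sets indexed by a connected set of indices is connected if adjacent
indices give sets joined by an edge. -/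
theorem connected_biUnion {V ι : Type*} {G : SimpleGraph V} {H : SimpleGraph ι} {I : Set ι}
    (hI : (H.induce I).Connected) (W : ι → Set V) (hW : ∀ i ∈ I, (G.induce (W i)).Connected)
    (hadj : ∀ i ∈ I, ∀ j ∈ I, H.Adj i j → ∃ a ∈ W i, ∃ b ∈ W j, G.Adj a b) :
    (G.induce (⋃ i ∈ I, W i)).Connected := by
  have sub : ∀ i ∈ I, W i ⊆ ⋃ i ∈ I, W i := fun i hi => Set.subset_biUnion_of_mem hi
  have one : ∀ i (hi : i ∈ I) a (ha : a ∈ W i) b (hb : b ∈ W i),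
      (G.induce (⋃ i ∈ I, W i)).Reachable ⟨a, sub i hi ha⟩ ⟨b, sub i hi hb⟩ := by
    intro i hi a ha b hb
    exact ((hW i hi).preconnected ⟨a, ha⟩ ⟨b, hb⟩).map
      (SimpleGraph.induceHomOfLE G (sub i hi)).toHom
  have key : ∀ i j : I, (H.induce I).Reachable i j → ∀ a (ha : a ∈ W i) b (hb : b ∈ W j),
      (G.induce (⋃ i ∈ I, W i)).Reachable ⟨a, sub i i.2 ha⟩ ⟨b, sub j j.2 hb⟩ := by
    rintro i j ⟨w⟩
    induction w with
    | nil => exact fun a ha b hb => one _ (Subtype.prop _) a ha b hb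
    | @cons u v w h _ ih =>
      intro a ha b hb
      obtain ⟨c, hc, d, hd, hcd⟩ := hadj u u.2 v v.2 h
      refine (one u u.2 a ha c hc).trans (SimpleGraph.Reachable.trans ?_ (ih d hd b hb))
      exact SimpleGraph.Adj.reachable (by simpa using hcd)
  obtain ⟨i⟩ := hI.nonempty
  obtain ⟨a⟩ := (hW i i.2).nonempty
  have : Nonempty (⋃ i ∈ I, W i : Set V) := ⟨⟨a, sub i i.2 a.2⟩⟩
  refine ⟨?_⟩
  rintro ⟨x, hx⟩ ⟨y, hy⟩
  obtain ⟨i, hi, hxi⟩ := Set.mem_iUnion₂.1 hx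
  obtain ⟨j, hj, hyj⟩ := Set.mem_iUnion₂.1 hy
  exact key ⟨i, hi⟩ ⟨j, hj⟩ (hI.preconnected _ _) x hxi y hyj

/-- A nonempty set that is not connected splits into two nonempty parts without edges between
them. -/
theorem exists_split {V : Type*} {G : SimpleGraph V} {A : Set V} (hne : A.Nonempty)
    (hA : ¬ (G.induce A).Connected) :
    ∃ P Q : Set V, P.Nonempty ∧ Q.Nonempty ∧ Disjoint P Q ∧ P ∪ Q = A ∧
      ∀ a ∈ P, ∀ b ∈ Q, ¬ G.Adj a b := by
  have : Nonempty A := hne.to_subtype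
  have h : ¬ (G.induce A).Preconnected := fun h => hA ⟨h⟩
  unfold SimpleGraph.Preconnected at h
  push Not at h
  obtain ⟨u, v, huv⟩ := h
  refine ⟨Subtype.val '' {x : A | (G.induce A).Reachable u x},
    Subtype.val '' {x : A | ¬ (G.induce A).Reachable u x},
    ⟨u, u, SimpleGraph.Reachable.refl _, rfl⟩, ⟨v, v, huv, rfl⟩, ?_, ?_, ?_⟩
  · rw [Set.disjoint_image_iff Subtype.val_injective, Set.disjoint_left]
    exact fun x hx hx' => hx' hx
  · rw [← Set.image_union]
    ext x
    simp only [Set.mem_image, Set.mem_union, Set.mem_ofPred_eq, Subtype.exists]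
    constructor
    · rintro ⟨a, ha, _, rfl⟩
      exact ha
    · exact fun hx => ⟨x, hx, em _, rfl⟩
  · rintro _ ⟨a, ha, rfl⟩ _ ⟨b, hb, rfl⟩ hab
    exact hb (SimpleGraph.Reachable.trans ha (SimpleGraph.Adj.reachable (by simpa using hab)))

theorem connected_singleton {V : Type*} (G : SimpleGraph V) (x : V) :
    (G.induce ({x} : Set V)).Connected :=
  have : Nonempty ({x} : Set V) := ⟨⟨x, rfl⟩⟩
  ⟨fun a b => by rw [Subsingleton.elim a b]⟩

theorem connected_insert {V : Type*} {G : SimpleGraph V} {A : Set V}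
    (hA : (G.induce A).Connected) {x y : V} (hx : x ∈ A) (h : G.Adj x y) :
    (G.induce (insert y A)).Connected := by
  have : insert y A = A ∪ {x, y} := by
    ext z
    simp only [Set.mem_insert_iff, Set.mem_union, Set.mem_singleton_iff]
    constructor
    · rintro (h | h) <;> simp [h]
    · rintro (h | rfl | h) <;> simp_all
  rw [this]
  exact SimpleGraph.induce_union_connected hA.preconnected
    (SimpleGraph.induce_pair_connected_of_adj h).preconnected ⟨x, hx, by simp⟩

/-! ### Counting adjacent pairs -/

/-- The ordered pairs of adjacent vertices of `S`. -/
def adjPairs {V : Type*} (G : SimpleGraph V) (S : Set V) : Set (V × V) :=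
  {p | p.1 ∈ S ∧ p.2 ∈ S ∧ G.Adj p.1 p.2}

/-- The number of ordered pairs of adjacent vertices of `S`. It is twice the number of edges inside
`S`, and easier to manipulate. -/
noncomputable def pairCount {V : Type*} (G : SimpleGraph V) (S : Set V) : ℕ :=
  (adjPairs G S).ncard

theorem two_mul_ncard_edgeSet {V : Type*} [Finite V] (G : SimpleGraph V) :
    2 * G.edgeSet.ncard = pairCount G Set.univ := by
  classical
  have := Fintype.ofFinite V
  rw [← SimpleGraph.coe_edgeFinset, Set.ncard_coe_finset, ← G.dart_card_eq_twice_card_edges,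
    pairCount, ← Nat.card_coe_set_eq, ← Nat.card_eq_fintype_card]
  exact Nat.card_congr
    { toFun := fun d => ⟨d.toProd, trivial, trivial, d.adj⟩
      invFun := fun p => ⟨p.1, p.2.2.2⟩
      left_inv := fun _ => rfl
      right_inv := fun _ => rfl }

theorem two_mul_e (G : FinGraph) : 2 * G.e = pairCount G.graph Set.univ :=
  two_mul_ncard_edgeSet G.graph

theorem pairCount_induce {V : Type*} (G : SimpleGraph V) (S : Set V) :
    pairCount (G.induce S) Set.univ = pairCount G S := by
  unfold pairCount
  rw [← Set.ncard_image_of_injective _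
    (Subtype.val_injective.prodMap Subtype.val_injective : Function.Injective
      (Prod.map (Subtype.val : S → V) (Subtype.val : S → V)))]
  congr 1
  ext ⟨a, b⟩
  simp only [Set.mem_image, Prod.exists, Prod.map, adjPairs, Set.mem_ofPred_eq, Set.mem_univ,
    true_and, Subtype.exists, SimpleGraph.comap_adj, Function.Embedding.subtype_apply,
    Prod.mk.injEq]
  constructor
  · rintro ⟨x, hx, y, hy, h, rfl, rfl⟩
    exact ⟨hx, hy, h⟩
  · rintro ⟨hx, hy, h⟩
    exact ⟨a, hx, b, hy, h, rfl, rfl⟩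

section Finite

variable {V : Type*} [Finite V] {G : SimpleGraph V}

theorem pairCount_singleton (x : V) : pairCount G {x} = 0 := by
  unfold pairCount
  rw [Set.ncard_eq_zero, Set.eq_empty_iff_forall_notMem]
  rintro ⟨a, b⟩ ⟨ha, hb, h⟩
  obtain rfl : a = x := ha
  obtain rfl : b = a := hb
  exact G.irrefl h

/-- A set of `n` vertices contains at most `n (n - 1)` ordered adjacent pairs, stated without
subtraction. -/
theorem pairCount_add_card_le_sq (S : Set V) :
    pairCount G S + S.ncard ≤ S.ncard * S.ncard := by
  unfold pairCount
  rw [← Set.ncard_prod, ← Set.ncard_image_of_injective S (f := fun x => (x, x))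
    (fun a b h => (Prod.ext_iff.1 h).1), ← Set.ncard_union_eq]
  · refine Set.ncard_le_ncard ?_
    rintro ⟨a, b⟩ (h | ⟨x, hx, h⟩)
    · exact ⟨h.1, h.2.1⟩
    · obtain ⟨rfl, rfl⟩ := Prod.ext_iff.1 h
      exact ⟨hx, hx⟩
  · rw [Set.disjoint_left]
    rintro ⟨a, b⟩ h ⟨x, hx, h'⟩
    obtain ⟨h1, h2⟩ := Prod.ext_iff.1 h'
    simp only at h1 h2
    subst h1 h2
    exact G.irrefl h.2.2

/-- If every edge inside `A` lies inside `S` or inside `T`, then `A` has at most as many edges as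
`S` and `T` together. -/
theorem pairCount_le_add {A S T : Set V}
    (h : ∀ a ∈ A, ∀ b ∈ A, G.Adj a b → (a ∈ S ∧ b ∈ S) ∨ (a ∈ T ∧ b ∈ T)) :
    pairCount G A ≤ pairCount G S + pairCount G T := by
  refine (Set.ncard_le_ncard (t := adjPairs G S ∪ adjPairs G T) ?_).trans (Set.ncard_union_le _ _)
  rintro ⟨a, b⟩ ⟨ha, hb, hab⟩
  rcases h a ha b hb hab with h | h
  · exact Or.inl ⟨h.1, h.2, hab⟩
  · exact Or.inr ⟨h.1, h.2, hab⟩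

omit [Finite V] in
theorem disjoint_adjPairs {S T : Set V} (h : (S ∩ T).Subsingleton) :
    Disjoint (adjPairs G S) (adjPairs G T) := by
  rw [Set.disjoint_left]
  rintro ⟨a, b⟩ ⟨ha, hb, hab⟩ ⟨ha', hb', -⟩
  exact G.ne_of_adj hab (h ⟨ha, ha'⟩ ⟨hb, hb'⟩)

theorem pairCount_union_ge {S T : Set V} (h : (S ∩ T).Subsingleton) :
    pairCount G S + pairCount G T ≤ pairCount G (S ∪ T) := by
  unfold pairCount
  rw [← Set.ncard_union_eq (disjoint_adjPairs h)]
  refine Set.ncard_le_ncard ?_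
  rintro ⟨a, b⟩ (h | h)
  · exact ⟨Or.inl h.1, Or.inl h.2.1, h.2.2⟩
  · exact ⟨Or.inr h.1, Or.inr h.2.1, h.2.2⟩

theorem pairCount_union_ge_of_adj {S T : Set V} (h : (S ∩ T).Subsingleton) {u z : V}
    (hu : u ∈ S) (hz : z ∈ T) (hu' : u ∉ T) (hz' : z ∉ S) (huz : G.Adj u z) :
    pairCount G S + pairCount G T + 2 ≤ pairCount G (S ∪ T) := by
  unfold pairCount
  have hne : (u, z) ≠ (z, u) := fun e => G.ne_of_adj huz (Prod.ext_iff.1 e).1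
  rw [← Set.ncard_union_eq (disjoint_adjPairs h), ← Set.ncard_pair hne, ← Set.ncard_union_eq]
  · refine Set.ncard_le_ncard ?_
    rintro ⟨a, b⟩ ((h | h) | (h | h))
    · exact ⟨Or.inl h.1, Or.inl h.2.1, h.2.2⟩
    · exact ⟨Or.inr h.1, Or.inr h.2.1, h.2.2⟩
    · obtain ⟨rfl, rfl⟩ := Prod.ext_iff.1 h
      exact ⟨Or.inl hu, Or.inr hz, huz⟩
    · obtain ⟨rfl, rfl⟩ := Prod.ext_iff.1 h
      exact ⟨Or.inr hz, Or.inl hu, huz.symm⟩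
  · rw [Set.disjoint_right]
    rintro ⟨a, b⟩ (h | h) (h' | h') <;> obtain ⟨rfl, rfl⟩ := Prod.ext_iff.1 h
    · exact hz' h'.2.1
    · exact hu' h'.1
    · exact hz' h'.1
    · exact hu' h'.2.1

theorem pairCount_insert_ge {T : Set V} {u y z : V} (hu : u ∉ T) (hy : y ∈ T) (hz : z ∈ T)
    (hyz : y ≠ z) (huy : G.Adj u y) (huz : G.Adj u z) :
    pairCount G T + 4 ≤ pairCount G (insert u T) := by
  have h1 : pairCount G T + 2 + 2 ≤ pairCount G (insert u T) := by
    unfold pairCount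
    have hne : (u, z) ≠ (z, u) := fun e => G.ne_of_adj huz (Prod.ext_iff.1 e).1
    have hne' : (u, y) ≠ (y, u) := fun e => G.ne_of_adj huy (Prod.ext_iff.1 e).1
    have hd : Disjoint (adjPairs G T) {(u, y), (y, u)} := by
      rw [Set.disjoint_right]
      rintro ⟨a, b⟩ (h | h) h' <;> obtain ⟨rfl, rfl⟩ := Prod.ext_iff.1 h
      · exact hu h'.1
      · exact hu h'.2.1
    have hd' : Disjoint (adjPairs G T ∪ {(u, y), (y, u)}) {(u, z), (z, u)} := by
      rw [Set.disjoint_right]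
      rintro ⟨a, b⟩ (h | h) (h' | h' | h') <;> obtain ⟨rfl, rfl⟩ := Prod.ext_iff.1 h
      · exact hu h'.1
      · exact hyz (Prod.ext_iff.1 h').2.symm
      · exact G.ne_of_adj huy (Prod.ext_iff.1 h').1
      · exact hu h'.2.1
      · exact G.ne_of_adj huz (Prod.ext_iff.1 h').1.symm
      · exact hyz (Prod.ext_iff.1 h').1.symm
    nth_rw 2 [← Set.ncard_pair hne]
    rw [← Set.ncard_pair hne', ← Set.ncard_union_eq hd, ← Set.ncard_union_eq]
    · refine Set.ncard_le_ncard ?_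
      rintro ⟨a, b⟩ ((h | h | h) | (h | h))
      · exact ⟨Or.inr h.1, Or.inr h.2.1, h.2.2⟩
      all_goals
        obtain ⟨rfl, rfl⟩ := Prod.ext_iff.1 h
        simp [adjPairs, *, huy.symm, huz.symm]
    · exact hd'
  omega

/-- Adding to `R` a set `A` of vertices with at most `r` neighbours each in `R`. -/
theorem pairCount_union_le {A R : Set V} {r : ℕ}
    (h : ∀ z ∈ A, {y ∈ R | G.Adj z y}.ncard ≤ r) :
    pairCount G (A ∪ R) + A.ncard ≤ pairCount G R + 2 * (A.ncard * r) + A.ncard * A.ncard := by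
  classical
  have := Fintype.ofFinite V
  set X : Set (V × V) := {p | p.1 ∈ A ∧ p.2 ∈ R ∧ G.Adj p.1 p.2} with hX
  have hXc : X.ncard ≤ A.ncard * r := by
    have : X = ((A.toFinset).biUnion fun z => ({y ∈ R | G.Adj z y}).toFinset.image
        fun y => (z, y) : Finset (V × V)) := by
      ext ⟨a, b⟩
      simp only [hX, Set.mem_ofPred_eq, Finset.coe_biUnion, Set.coe_toFinset, Finset.coe_image,
        Set.mem_iUnion₂, Set.mem_image, Prod.mk.injEq]
      exact ⟨fun ⟨ha, hb, hab⟩ => ⟨a, ha, b, ⟨hb, hab⟩, rfl, rfl⟩,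
        fun ⟨_, ha, _, ⟨hb, hab⟩, h1, h2⟩ => by subst h1 h2; exact ⟨ha, hb, hab⟩⟩
    rw [this, Set.ncard_coe_finset, Set.ncard_eq_toFinset_card' A]
    refine Finset.card_biUnion_le_card_mul _ _ _ fun z hz => ?_
    refine Finset.card_image_le.trans ?_
    rw [← Set.ncard_eq_toFinset_card']
    exact h z (by simpa using hz)
  have hX' : (Prod.swap '' X).ncard = X.ncard := Set.ncard_image_of_injective _ Prod.swap_injective
  have hsub : adjPairs G (A ∪ R) ⊆ (adjPairs G R ∪ (X ∪ Prod.swap '' X)) ∪ adjPairs G A := by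
    rintro ⟨a, b⟩ ⟨ha, hb, hab⟩
    rcases ha with ha | ha <;> rcases hb with hb | hb
    · exact Or.inr ⟨ha, hb, hab⟩
    · exact Or.inl (Or.inr (Or.inl ⟨ha, hb, hab⟩))
    · exact Or.inl (Or.inr (Or.inr ⟨(b, a), ⟨hb, ha, hab.symm⟩, rfl⟩))
    · exact Or.inl (Or.inl ⟨ha, hb, hab⟩)
  have h1 := Set.ncard_le_ncard hsub
  have h2 := Set.ncard_union_le (adjPairs G R ∪ (X ∪ Prod.swap '' X)) (adjPairs G A)
  have h3 := Set.ncard_union_le (adjPairs G R) (X ∪ Prod.swap '' X)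
  have h4 := Set.ncard_union_le X (Prod.swap '' X)
  have h5 := pairCount_add_card_le_sq (G := G) A
  unfold pairCount at *
  omega

/-- A bound on the number of edges in connected sets, linear in the size of the set, holds for all
sets. -/
theorem pairCount_le_of_connected {β : ℝ}
    (h : ∀ S : Set V, (G.induce S).Connected → (pairCount G S : ℝ) ≤ 2 * β * S.ncard)
    (S : Set V) : (pairCount G S : ℝ) ≤ 2 * β * S.ncard := by
  induction hn : S.ncard using Nat.strong_induction_on generalizing S with
  | _ n ih =>
    subst hn
    rcases S.eq_empty_or_nonempty with rfl | hne
    · simp [pairCount, adjPairs]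
    by_cases hc : (G.induce S).Connected
    · exact h S hc
    obtain ⟨P, Q, hP, hQ, hd, rfl, hPQ⟩ := exists_split hne hc
    have hcard := Set.ncard_union_eq hd
    have hPpos := (Set.ncard_pos (s := P)).2 hP
    have hQpos := (Set.ncard_pos (s := Q)).2 hQ
    have h1 := ih P.ncard (by omega) P rfl
    have h2 := ih Q.ncard (by omega) Q rfl
    have h3 : pairCount G (P ∪ Q) ≤ pairCount G P + pairCount G Q := by
      apply pairCount_le_add
      rintro a (ha | ha) b (hb | hb) hab
      · exact Or.inl ⟨ha, hb⟩
      · exact absurd hab (hPQ a ha b hb)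
      · exact absurd hab.symm (hPQ b hb a ha)
      · exact Or.inr ⟨ha, hb⟩
    have h4 : (pairCount G (P ∪ Q) : ℝ) ≤ pairCount G P + pairCount G Q := by exact_mod_cast h3
    rw [hcard]
    push_cast
    linarith

/-- A connected set of `n` vertices contains at least `n - 1` edges. -/
theorem le_pairCount_of_connected {S : Set V} (hS : (G.induce S).Connected) :
    2 * S.ncard ≤ pairCount G S + 2 := by
  have h := hS.card_vert_le_card_edgeSet_add_one
  have h2 := two_mul_ncard_edgeSet (G.induce S)
  rw [pairCount_induce] at h2
  rw [Nat.card_coe_set_eq, Nat.card_coe_set_eq] at h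
  omega

end Finite

/-! ### Minors -/

/-- The subgraph of `G` induced on a nonempty set of vertices. -/
def FinGraph.restrict (G : FinGraph) (S : Set G.V) (h : S.Nonempty) : FinGraph :=
  have := h.to_subtype
  ⟨S, G.graph.induce S⟩

theorem FinGraph.v_restrict (G : FinGraph) (S : Set G.V) (h : S.Nonempty) :
    (G.restrict S h).v = S.ncard :=
  Nat.card_coe_set_eq S

theorem FinGraph.two_mul_e_restrict (G : FinGraph) (S : Set G.V) (h : S.Nonempty) :
    2 * (G.restrict S h).e = pairCount G.graph S := by
  rw [two_mul_e]
  exact pairCount_induce G.graph S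

theorem FinGraph.v_pos (G : FinGraph) : 0 < G.v := Nat.card_pos

theorem FinGraph.e_le_sq (G : FinGraph) : 2 * G.e + G.v ≤ G.v * G.v := by
  rw [two_mul_e, FinGraph.v, ← Set.ncard_univ]
  exact pairCount_add_card_le_sq _

theorem isMinor_of_le {H G : FinGraph} (f : H.V → G.V) (hf : Function.Injective f)
    (h : ∀ x y, H.graph.Adj x y → G.graph.Adj (f x) (f y)) : IsMinor H G :=
  ⟨fun x => {f x}, fun _ => connected_singleton _ _,
    fun _ _ hxy => Set.disjoint_singleton.2 fun e => hxy (hf e),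
    fun x y hxy => ⟨f x, rfl, f y, rfl, h x y hxy⟩⟩

theorem isMinor_refl (G : FinGraph) : IsMinor G G :=
  isMinor_of_le id Function.injective_id fun _ _ h => h

theorem isMinor_restrict (G : FinGraph) (S : Set G.V) (h : S.Nonempty) :
    IsMinor (G.restrict S h) G :=
  isMinor_of_le Subtype.val Subtype.val_injective fun _ _ h => h

theorem isMinor_trans {K H G : FinGraph} (h₁ : IsMinor K H) (h₂ : IsMinor H G) : IsMinor K G := by
  obtain ⟨W, hW, hWd, hWa⟩ := h₁
  obtain ⟨U, hU, hUd, hUa⟩ := h₂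
  refine ⟨fun z => ⋃ x ∈ W z, U x, fun z => ?_, fun y z hyz => ?_, fun y z hyz => ?_⟩
  · exact connected_biUnion (hW z) U (fun x _ => hU x) fun x _ y _ h => hUa x y h
  · rw [Set.disjoint_left]
    intro a ha hb
    obtain ⟨i, hi, hai⟩ := Set.mem_iUnion₂.1 ha
    obtain ⟨j, hj, haj⟩ := Set.mem_iUnion₂.1 hb
    have hij : i ≠ j := by
      rintro rfl
      exact Set.disjoint_left.1 (hWd y z hyz) hi hj
    exact Set.disjoint_left.1 (hUd i j hij) hai haj
  · obtain ⟨i, hi, j, hj, hij⟩ := hWa y z hyz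
    obtain ⟨a, ha, b, hb, hab⟩ := hUa i j hij
    exact ⟨a, Set.mem_biUnion hi ha, b, Set.mem_biUnion hj hb, hab⟩

theorem IsMinor.v_le {H G : FinGraph} (h : IsMinor H G) : H.v ≤ G.v := by
  obtain ⟨W, hW, hd, -⟩ := h
  have hne : ∀ x, ∃ a, a ∈ W x := fun x => Set.nonempty_coe_sort.1 (hW x).nonempty
  choose f hf using hne
  refine Nat.card_le_card_of_injective f fun x y hxy => ?_
  by_contra hne
  exact Set.disjoint_left.1 (hd x y hne) (hf x) (by rw [hxy]; exact hf y)

/-- The edges of a minor inject into the edges of the graph, and if this injection is onto and the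
vertex numbers agree, then the two graphs are isomorphic. -/
theorem IsMinor.e_le_and {H G : FinGraph} (h : IsMinor H G) :
    H.e ≤ G.e ∧ (G.v ≤ H.v → G.e ≤ H.e → H.Isomorphic G) := by
  obtain ⟨W, hW, hd, ha⟩ := h
  have huniq : ∀ {x y a}, a ∈ W x → a ∈ W y → x = y := by
    intro x y a hx hy
    by_contra hne
    exact Set.disjoint_left.1 (hd x y hne) hx hy
  choose! f hf g hg hfg using ha
  let F : H.V × H.V → G.V × G.V := fun p => (f p.1 p.2, g p.1 p.2)
  have hmaps : ∀ p ∈ adjPairs H.graph Set.univ, F p ∈ adjPairs G.graph Set.univ :=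
    fun p hp => ⟨trivial, trivial, hfg _ _ hp.2.2⟩
  have hinj : Set.InjOn F (adjPairs H.graph Set.univ) := by
    rintro ⟨x, y⟩ ⟨-, -, hxy⟩ ⟨x', y'⟩ ⟨-, -, hxy'⟩ e
    obtain ⟨e1, e2⟩ := Prod.ext_iff.1 e
    have h1 := hf x y hxy
    have h2 := hg x y hxy
    simp only [F] at e1 e2
    rw [e1] at h1
    rw [e2] at h2
    exact Prod.ext (huniq h1 (hf x' y' hxy')) (huniq h2 (hg x' y' hxy'))
  have hle := Set.ncard_le_ncard_of_injOn F hmaps hinj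
  have hH := two_mul_e H
  have hG := two_mul_e G
  refine ⟨by unfold pairCount at *; omega, fun hv he => ?_⟩
  have hne : ∀ x, ∃ a, a ∈ W x := fun x => Set.nonempty_coe_sort.1 (hW x).nonempty
  choose ρ hρ using hne
  have hρi : Function.Injective ρ := fun x y e => huniq (hρ x) (by rw [e]; exact hρ y)
  have hρb : Function.Bijective ρ := by
    refine (Nat.bijective_iff_injective_and_card _).2 ⟨hρi, ?_⟩
    exact le_antisymm (Nat.card_le_card_of_injective _ hρi) hv
  have hWρ : ∀ x a, a ∈ W x → a = ρ x := by
    intro x a hax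
    obtain ⟨y, rfl⟩ := hρb.2 a
    rw [huniq hax (hρ y)]
  have himg : F '' adjPairs H.graph Set.univ = adjPairs G.graph Set.univ := by
    refine Set.eq_of_subset_of_ncard_le (Set.image_subset_iff.2 hmaps) ?_
    rw [hinj.ncard_image]
    unfold pairCount at *
    omega
  refine ⟨⟨Equiv.ofBijective ρ hρb, ?_⟩⟩
  intro x y
  constructor
  · intro h
    have : (ρ x, ρ y) ∈ F '' adjPairs H.graph Set.univ := by
      rw [himg]
      exact ⟨trivial, trivial, h⟩
    obtain ⟨⟨x', y'⟩, ⟨-, -, hxy⟩, e⟩ := this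
    obtain ⟨e1, e2⟩ := Prod.ext_iff.1 e
    simp only [F] at e1 e2
    have h1 := hf x' y' hxy
    have h2 := hg x' y' hxy
    rw [e1] at h1
    rw [e2] at h2
    rwa [huniq (hρ x) h1, huniq (hρ y) h2]
  · intro h
    have := hfg x y h
    rwa [hWρ x _ (hf x y h), hWρ y _ (hg x y h)] at this

theorem IsMinor.e_le {H G : FinGraph} (h : IsMinor H G) : H.e ≤ G.e := h.e_le_and.1

theorem FinGraph.Isomorphic.v_eq {H G : FinGraph} (h : H.Isomorphic G) : H.v = G.v :=
  h.elim fun f => Nat.card_congr f.toEquiv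

theorem FinGraph.Isomorphic.symm {H G : FinGraph} (h : H.Isomorphic G) : G.Isomorphic H :=
  h.elim fun f => ⟨f.symm⟩

theorem FinGraph.Isomorphic.isMinor {H G : FinGraph} (h : H.Isomorphic G) : IsMinor H G :=
  h.elim fun f => isMinor_of_le f f.injective fun _ _ h => f.map_adj_iff.2 h

theorem FinGraph.Isomorphic.e_eq {H G : FinGraph} (h : H.Isomorphic G) : H.e = G.e :=
  le_antisymm h.isMinor.e_le h.symm.isMinor.e_le

theorem IsMinor.isProperMinor_of_v_lt {H G : FinGraph} (h : IsMinor H G) (hlt : H.v < G.v) :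
    IsProperMinor H G :=
  ⟨h, fun hi => hlt.ne hi.v_eq⟩

/-- Every graph outside a class has a minor that is an excluded minor for the class. -/
theorem exists_isExcludedMinor (𝒜 : Set FinGraph) {G : FinGraph} (hG : G ∉ 𝒜) :
    ∃ X, IsMinor X G ∧ IsExcludedMinor 𝒜 X := by
  let p : ℕ → Prop := fun n => ∃ X : FinGraph, IsMinor X G ∧ X ∉ 𝒜 ∧ X.v + X.e = n
  have hp : ∃ n, p n := ⟨_, G, isMinor_refl G, hG, rfl⟩
  classical
  obtain ⟨X, hXG, hX, hn⟩ := Nat.find_spec hp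
  refine ⟨X, hXG, hX, fun Y hY => ?_⟩
  by_contra hYA
  have h1 := Nat.find_min' hp ⟨Y, isMinor_trans hY.1 hXG, hYA, rfl⟩
  have h2 := hY.1.v_le
  have h3 := hY.1.e_le
  exact hY.2 (hY.1.e_le_and.2 (by omega) (by omega))

theorem FinGraph.density_le_iff {G : FinGraph} {β : ℝ} : G.density ≤ β ↔ (G.e : ℝ) ≤ β * G.v := by
  unfold FinGraph.density
  rw [div_le_iff₀ (by exact_mod_cast G.v_pos)]

theorem FinGraph.le_density_iff {G : FinGraph} {β : ℝ} : β ≤ G.density ↔ β * G.v ≤ (G.e : ℝ) := by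
  unfold FinGraph.density
  rw [le_div_iff₀ (by exact_mod_cast G.v_pos)]

theorem FinGraph.density_nonneg (G : FinGraph) : 0 ≤ G.density := by
  unfold FinGraph.density
  positivity

/-- The complete graph on `n + 1` vertices. -/
def completeFinGraph (n : ℕ) : FinGraph := ⟨Fin (n + 1), ⊤⟩

theorem e_completeFinGraph (n : ℕ) : 2 * (completeFinGraph n).e = (n + 1) * n := by
  have h : adjPairs (⊤ : SimpleGraph (Fin (n + 1))) Set.univ =
      ((Finset.univ.offDiag : Finset (Fin (n + 1) × Fin (n + 1))) : Set _) := by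
    ext p
    simp [adjPairs]
  have h2 : (Finset.univ.offDiag : Finset (Fin (n + 1) × Fin (n + 1))).card = (n + 1) * n := by
    rw [Finset.offDiag_card]
    simp [Nat.mul_succ]
  rw [two_mul_e]
  change pairCount (⊤ : SimpleGraph (Fin (n + 1))) Set.univ = _
  rw [pairCount, h, Set.ncard_coe_finset, h2]

/-- A class of graphs of bounded density does not contain all complete graphs. -/
theorem ne_univ_of_density_le {𝒜 : Set FinGraph} {β : ℝ} (h : ∀ G ∈ 𝒜, G.density ≤ β) :
    𝒜 ≠ Set.univ := by
  rintro rfl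
  obtain ⟨n, hn⟩ := exists_nat_gt (2 * β)
  have h1 := FinGraph.density_le_iff.1 (h (completeFinGraph n) trivial)
  have h2 : (completeFinGraph n).v = n + 1 := by simp [FinGraph.v, completeFinGraph]
  have h3 : (2 : ℝ) * (completeFinGraph n).e = (n + 1) * n := by
    exact_mod_cast e_completeFinGraph n
  rw [h2] at h1
  push_cast at h1
  have : (0 : ℝ) < n + 1 := by positivity
  nlinarith

/-! ### Gluing copies of a graph at a vertex -/

section Glue

variable {V : Type*} (m : ℕ) (r : V)

/-- The vertex set of the graph made of `m` copies of a graph on `V` that share the vertex `r`: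
`none` is the shared vertex. -/
abbrev GlueVertex : Type _ := Option (Fin m × {x : V // x ≠ r})

variable {m r}

/-- The vertex of the original graph of which a vertex of the glued graph is a copy. -/
def GlueVertex.base : GlueVertex m r → V
  | none => r
  | some p => p.2

/-- The copy to which a vertex of the glued graph belongs; `none` for the shared vertex. -/
def GlueVertex.copy : GlueVertex m r → Option (Fin m)
  | none => none
  | some p => some p.1

theorem GlueVertex.ext {a b : GlueVertex m r} (h : a.base = b.base) (h' : a.copy = b.copy) :
    a = b := by
  rcases a with _ | ⟨i, x⟩ <;> rcases b with _ | ⟨j, y⟩ <;>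
    simp_all [GlueVertex.base, GlueVertex.copy, Subtype.ext_iff]

theorem GlueVertex.copy_eq_none {a : GlueVertex m r} : a.copy = none ↔ a = none := by
  rcases a with _ | ⟨i, x⟩ <;> simp [GlueVertex.copy]

theorem GlueVertex.base_eq {a : GlueVertex m r} : a.base = r ↔ a = none := by
  rcases a with _ | ⟨i, x⟩
  · simp [GlueVertex.base]
  · simpa [GlueVertex.base] using x.2

/-- The `i`-th copy of the vertex `x`. -/
noncomputable def GlueVertex.lift (i : Fin m) (x : V) : GlueVertex m r :=
  open Classical in if h : x = r then none else some (i, ⟨x, h⟩)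

theorem GlueVertex.base_lift (i : Fin m) (x : V) : (GlueVertex.lift (r := r) i x).base = x := by
  unfold GlueVertex.lift
  split_ifs with h <;> simp [GlueVertex.base, h]

theorem GlueVertex.copy_lift (i : Fin m) {x : V} (h : x ≠ r) :
    (GlueVertex.lift (r := r) i x).copy = some i := by
  simp [GlueVertex.lift, GlueVertex.copy, h]

theorem GlueVertex.lift_self (i : Fin m) : (GlueVertex.lift i r : GlueVertex m r) = none := by
  simp [GlueVertex.lift]

end Glue

open GlueVertex

/-- The graph made of `m` copies of `G` that share the vertex `r` and are otherwise disjoint. -/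
abbrev FinGraph.glue (G : FinGraph) (m : ℕ) (r : G.V) : FinGraph where
  V := GlueVertex m r
  graph :=
    { Adj := fun a b => G.graph.Adj (base a) (base b) ∧
        (copy a = none ∨ copy b = none ∨ copy a = copy b)
      symm := ⟨fun _ _ h => ⟨h.1.symm, by tauto⟩⟩
      loopless := ⟨fun _ h => G.graph.irrefl h.1⟩ }

theorem FinGraph.v_glue (G : FinGraph) (m : ℕ) (r : G.V) :
    (G.glue m r).v = m * (G.v - 1) + 1 := by
  have : Fintype G.V := Fintype.ofFinite _
  classical
  change Nat.card (Option (Fin m × {x : G.V // x ≠ r})) = _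
  rw [Finite.card_option, Nat.card_prod, Nat.card_fin]
  congr 2
  rw [FinGraph.v, Nat.card_eq_fintype_card, Nat.card_eq_fintype_card, Fintype.card_subtype_compl,
    Fintype.card_subtype_eq]

theorem FinGraph.le_e_glue (G : FinGraph) (m : ℕ) (r : G.V) : m * G.e ≤ (G.glue m r).e := by
  let F : Fin m × (G.V × G.V) → (G.glue m r).V × (G.glue m r).V :=
    fun p => (lift p.1 p.2.1, lift p.1 p.2.2)
  have h : ((Set.univ : Set (Fin m)) ×ˢ adjPairs G.graph Set.univ).ncard ≤
      (adjPairs (G.glue m r).graph Set.univ).ncard := by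
    refine Set.ncard_le_ncard_of_injOn F ?_ ?_
    · rintro ⟨i, x, y⟩ ⟨-, -, -, hxy⟩
      refine ⟨trivial, trivial, ?_, ?_⟩
      · simpa [F, base_lift] using hxy
      · by_cases hx : x = r
        · exact Or.inl (by simp [F, hx, lift_self, copy])
        by_cases hy : y = r
        · exact Or.inr (Or.inl (by simp [F, hy, lift_self, copy]))
        · exact Or.inr (Or.inr (by simp [F, copy_lift, hx, hy]))
    · rintro ⟨i, x, y⟩ ⟨-, -, -, hxy⟩ ⟨j, x', y'⟩ ⟨-, -, -, hxy'⟩ e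
      obtain ⟨e1, e2⟩ := Prod.ext_iff.1 e
      simp only [F] at e1 e2
      have h1 := congrArg base e1
      have h2 := congrArg base e2
      rw [base_lift, base_lift] at h1 h2
      subst h1 h2
      have hij : i = j := by
        by_cases hx : x = r
        · have hy : y ≠ r := fun hy => G.graph.ne_of_adj hxy (hx.trans hy.symm)
          have := congrArg copy e2
          rw [copy_lift _ hy, copy_lift _ hy] at this
          exact Option.some_injective _ this
        · have := congrArg copy e1
          rw [copy_lift _ hx, copy_lift _ hx] at this
          exact Option.some_injective _ this
      rw [hij]
  rw [Set.ncard_prod, Set.ncard_univ, Nat.card_fin] at h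
  have h1 := two_mul_e G
  have h2 := two_mul_e (G.glue m r)
  unfold pairCount at h1 h2
  rw [← h1, ← h2] at h
  nlinarith

/-- A `2`-connected minor of the glued graph lives in a single copy: all branch sets that avoid the
shared vertex are in the same copy, and the rest of the graph can be collapsed to the shared
vertex. -/
theorem isMinor_of_isMinor_glue {X G : FinGraph} {m : ℕ} {r : G.V} (hX : X.IsTConnected 2)
    (h : IsMinor X (G.glue m r)) : IsMinor X G := by
  obtain ⟨W, hW, hd, ha⟩ := h
  have huniq : ∀ {x y a}, a ∈ W x → a ∈ W y → x = y := by
    intro x y a hx hy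
    by_contra hne
    exact Set.disjoint_left.1 (hd x y hne) hx hy
  let S : Set X.V := {x | (none : GlueVertex m r) ∈ W x}
  have hS : S.ncard < 2 := by
    have : S.Subsingleton := fun x hx y hy => huniq hx hy
    have := Set.ncard_le_one_iff_subsingleton.2 this
    omega
  have hconn := hX.2 S hS
  have hU := connected_biUnion hconn W (fun x _ => hW x) fun x _ y _ h => ha x y h
  have hmemU : ∀ {x a}, x ∈ Sᶜ → a ∈ W x → a ∈ ⋃ x ∈ Sᶜ, W x :=
    fun hx ha => Set.mem_biUnion hx ha
  have hnone : ∀ a ∈ ⋃ x ∈ Sᶜ, W x, copy a ≠ none := by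
    intro a haU hc
    obtain ⟨x, hx, hax⟩ := Set.mem_iUnion₂.1 haU
    rw [copy_eq_none] at hc
    subst hc
    exact hx hax
  obtain ⟨a₀, ha₀⟩ := Set.nonempty_coe_sort.1 hU.nonempty
  obtain ⟨j, hj⟩ := Option.ne_none_iff_exists'.1 (hnone a₀ ha₀)
  have hcopy : ∀ a ∈ ⋃ x ∈ Sᶜ, W x, copy a = some j := by
    intro a haU
    rw [← hj]
    refine const_of_connected hU copy (fun b hb c hc hbc => ?_) haU ha₀
    have h1 := hnone b hb
    have h2 := hnone c hc
    have h3 := hbc.2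
    tauto
  classical
  let φ : GlueVertex m r → G.V := fun a => if copy a = some j then base a else r
  have hφ : ∀ a b, (G.glue m r).graph.Adj a b → φ a = φ b ∨ G.graph.Adj (φ a) (φ b) := by
    rintro a b ⟨hab, hc⟩
    simp only [φ]
    split_ifs with h1 h2 h2
    · exact Or.inr hab
    · have : b = none := by
        rw [← copy_eq_none]
        rcases hc with hc | hc | hc
        · simp [hc] at h1
        · exact hc
        · exact absurd (hc.symm.trans h1) h2
      subst this
      exact Or.inr hab
    · have : a = none := by
        rw [← copy_eq_none]
        rcases hc with hc | hc | hc
        · exact hc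
        · simp [hc] at h2
        · exact absurd (hc.trans h2) h1
      subst this
      exact Or.inr hab
    · exact Or.inl rfl
  have key : ∀ x y a b, x ∉ S → x ≠ y → a ∈ W x → b ∈ W y → φ a ≠ φ b := by
    intro x y a b hx hxy hax hby e
    have hca := hcopy a (hmemU hx hax)
    have hφa : φ a = base a := if_pos hca
    have hne : base a ≠ r := by
      rw [Ne, base_eq, ← copy_eq_none, hca]
      simp
    have hcb : copy b = some j := by
      by_contra hcb
      have hφb : φ b = r := if_neg hcb
      exact hne (by rw [← hφa, e, hφb])
    have hφb : φ b = base b := if_pos hcb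
    have : a = b := GlueVertex.ext (by rw [← hφa, ← hφb, e]) (by rw [hca, hcb])
    subst this
    exact hxy (huniq hax hby)
  have key' : ∀ x y a b, x ≠ y → a ∈ W x → b ∈ W y → φ a ≠ φ b := by
    intro x y a b hxy hax hby
    by_cases hx : x ∈ S
    · have hy : y ∉ S := fun hy => hxy (huniq hx hy)
      exact (key y x b a hy hxy.symm hby hax).symm
    · exact key x y a b hx hxy hax hby
  refine ⟨fun x => φ '' W x, fun x => connected_image (hW x) φ fun a _ b _ h => hφ a b h,
    fun x y hxy => ?_, fun x y hxy => ?_⟩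
  · rw [Set.disjoint_left]
    rintro _ ⟨a, hax, rfl⟩ ⟨b, hby, e⟩
    exact key' x y a b hxy hax hby e.symm
  · obtain ⟨a, hax, b, hby, hab⟩ := ha x y hxy
    exact ⟨φ a, ⟨a, hax, rfl⟩, φ b, ⟨b, hby, rfl⟩, (hφ a b hab).resolve_left
      (key' x y a b (X.graph.ne_of_adj hxy) hax hby)⟩

theorem glue_mem {𝒜 : Set FinGraph} (hmc : MinorClosed 𝒜)
    (hex : ∀ G, IsExcludedMinor 𝒜 G → G.IsTConnected 2) {G : FinGraph} (hG : G ∈ 𝒜) (m : ℕ)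
    (r : G.V) : G.glue m r ∈ 𝒜 := by
  by_contra h
  obtain ⟨X, hX, hXex⟩ := exists_isExcludedMinor 𝒜 h
  exact hXex.1 (hmc G hG X (isMinor_of_isMinor_glue (hex X hXex) hX))

/-- Gluing many copies turns a bound on `e / v` into a bound on `e / (v - 1)`. -/
theorem e_le_of_density_le {𝒜 : Set FinGraph} (hmc : MinorClosed 𝒜)
    (hex : ∀ G, IsExcludedMinor 𝒜 G → G.IsTConnected 2) {β : ℝ}
    (hβ : ∀ G ∈ 𝒜, G.density ≤ β) {G : FinGraph} (hG : G ∈ 𝒜) : (G.e : ℝ) ≤ β * (G.v - 1) := by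
  by_contra! h
  obtain ⟨r⟩ := G.nonempty
  obtain ⟨m, hm⟩ := Archimedean.arch β (sub_pos.2 h)
  have h1 := FinGraph.density_le_iff.1 (hβ _ (glue_mem hmc hex hG (m + 1) r))
  have h2 : (((m + 1) * G.e : ℕ) : ℝ) ≤ (G.glue (m + 1) r).e := by
    exact_mod_cast G.le_e_glue (m + 1) r
  rw [G.v_glue] at h1
  have h3 : ((G.v - 1 : ℕ) : ℝ) = G.v - 1 := by
    rw [Nat.cast_sub G.v_pos]
    simp
  push_cast [h3] at h1 h2
  rw [nsmul_eq_mul] at hm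
  nlinarith

/-! ### Classes with 2-connected excluded minors -/

/-- The graphs all of whose minors have at most `c (v - 1)` edges. -/
def sparseClass (c : ℝ) : Set FinGraph :=
  {G | ∀ H, IsMinor H G → (H.e : ℝ) ≤ c * (H.v - 1)}

theorem minorClosed_sparseClass (c : ℝ) : MinorClosed (sparseClass c) :=
  fun _ hG _ hH K hK => hG K (isMinor_trans hK hH)

/-- The excluded minors for `sparseClass c` are `2`-connected, since the bound `e ≤ c (v - 1)`
passes from the two sides of a cut vertex to the whole graph. -/
theorem isTConnected_of_isExcludedMinor_sparseClass {c : ℝ} (hc : 1 ≤ c) {G : FinGraph}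
    (hG : IsExcludedMinor (sparseClass c) G) : G.IsTConnected 2 := by
  obtain ⟨hGn, hGp⟩ := hG
  have hbig : c * (G.v - 1) < G.e := by
    by_contra! hle
    refine hGn fun M hM => ?_
    by_cases hp : M.Isomorphic G
    · rw [hp.e_eq, hp.v_eq]
      exact hle
    · exact hGp M ⟨hM, hp⟩ M (isMinor_refl M)
  have hsmall : ∀ S : Set G.V, S.Nonempty → S.ncard < G.v →
      (pairCount G.graph S : ℝ) ≤ 2 * c * (S.ncard - 1) := by
    intro S hS hlt
    have h1 := hGp _ ((isMinor_restrict G S hS).isProperMinor_of_v_lt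
      (by rwa [G.v_restrict])) _ (isMinor_refl _)
    rw [G.v_restrict] at h1
    have h2 : (2 : ℝ) * (G.restrict S hS).e = pairCount G.graph S := by
      exact_mod_cast G.two_mul_e_restrict S hS
    linarith
  have hv : 2 < G.v := by
    by_contra! hv
    have h0 := G.v_pos
    have h1 := G.e_le_sq
    have h2 : G.v = 1 ∨ G.v = 2 := by omega
    rcases h2 with h2 | h2 <;> rw [h2] at h1 hbig
    · have : G.e = 0 := by omega
      rw [this] at hbig
      norm_num at hbig
    · have : G.e ≤ 1 := by omega
      have : (G.e : ℝ) ≤ 1 := by exact_mod_cast this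
      norm_num at hbig
      linarith
  refine ⟨hv, fun S hS => ?_⟩
  by_contra hcon
  have hcard := Set.ncard_add_ncard_compl S
  change _ = G.v at hcard
  have hne : Sᶜ.Nonempty := by
    rw [← Set.ncard_pos]
    omega
  obtain ⟨P, Q, hP, hQ, hPQ, hun, hadj⟩ := exists_split hne hcon
  have hPQc := Set.ncard_union_eq hPQ
  rw [hun] at hPQc
  have hPd : Disjoint P S := by
    rw [Set.disjoint_left]
    intro x hx hxS
    exact (hun ▸ Or.inl hx : x ∈ Sᶜ) hxS
  have hQd : Disjoint Q S := by
    rw [Set.disjoint_left]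
    intro x hx hxS
    exact (hun ▸ Or.inr hx : x ∈ Sᶜ) hxS
  have hPS := Set.ncard_union_eq hPd
  have hQS := Set.ncard_union_eq hQd
  have hPpos := (Set.ncard_pos (s := P)).2 hP
  have hQpos := (Set.ncard_pos (s := Q)).2 hQ
  have h1 := hsmall (P ∪ S) hP.inl (by omega)
  have h2 := hsmall (Q ∪ S) hQ.inl (by omega)
  have h3 : pairCount G.graph Set.univ ≤ pairCount G.graph (P ∪ S) + pairCount G.graph (Q ∪ S) := by
    apply pairCount_le_add
    intro a _ b _ hab
    have hmem : ∀ x, x ∈ S ∨ x ∈ P ∨ x ∈ Q := by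
      intro x
      by_cases hx : x ∈ S
      · exact Or.inl hx
      · exact Or.inr (hun.symm ▸ hx : x ∈ P ∪ Q)
    have h4 := hadj a
    have h5 := hadj b
    rcases hmem a with ha | ha | ha <;> rcases hmem b with hb | hb | hb
    · exact Or.inl ⟨Or.inr ha, Or.inr hb⟩
    · exact Or.inl ⟨Or.inr ha, Or.inl hb⟩
    · exact Or.inr ⟨Or.inr ha, Or.inl hb⟩
    · exact Or.inl ⟨Or.inl ha, Or.inr hb⟩
    · exact Or.inl ⟨Or.inl ha, Or.inl hb⟩
    · exact absurd hab (h4 ha b hb)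
    · exact Or.inr ⟨Or.inl ha, Or.inr hb⟩
    · exact absurd hab.symm (h5 hb a ha)
    · exact Or.inr ⟨Or.inl ha, Or.inl hb⟩
  rw [← two_mul_e] at h3
  have h3' : (2 : ℝ) * G.e ≤ pairCount G.graph (P ∪ S) + pairCount G.graph (Q ∪ S) := by
    exact_mod_cast h3
  have h6 : ((P ∪ S).ncard : ℝ) + (Q ∪ S).ncard ≤ G.v + 1 := by
    have : (P ∪ S).ncard + (Q ∪ S).ncard ≤ G.v + 1 := by omega
    exact_mod_cast this
  nlinarith

/-- If graphs in `sparseClass c` come arbitrarily close to the bound `e ≤ c (v - 1)`, then `c` is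
the critical density of this class. -/
theorem mem_Bt_two {c : ℝ} (hc : 1 ≤ c)
    (h : ∀ b < c, ∃ G ∈ sparseClass c, b * (G.v - 1) < (G.e : ℝ)) : c ∈ Bt 2 := by
  have hup : ∀ G ∈ sparseClass c, G.density ≤ c := by
    intro G hG
    rw [FinGraph.density_le_iff]
    have := hG G (isMinor_refl G)
    linarith
  have hex : ∀ G, IsExcludedMinor (sparseClass c) G → G.IsTConnected 2 :=
    fun G hG => isTConnected_of_isExcludedMinor_sparseClass hc hG
  obtain ⟨G, hG, -⟩ := h (c - 1) (by linarith)
  refine ⟨sparseClass c, ⟨⟨G, hG⟩, ne_univ_of_density_le hup⟩,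
    minorClosed_sparseClass c, hex, ?_, ?_⟩
  · rintro _ ⟨G, hG, rfl⟩
    exact hup G hG
  · intro b hb
    by_contra! hlt
    obtain ⟨G, hG, hGb⟩ := h b hlt
    have := e_le_of_density_le (minorClosed_sparseClass c) hex
      (fun G hG => hb ⟨G, hG, rfl⟩) hG
    linarith

/-- The cone over `G`: a new vertex `none` is joined to all vertices of `G`. -/
abbrev FinGraph.cone (G : FinGraph) : FinGraph where
  V := Option G.V
  graph :=
    { Adj := fun a b => a ≠ b ∧ ∀ x ∈ a, ∀ y ∈ b, G.graph.Adj x y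
      symm := ⟨fun _ _ h => ⟨h.1.symm, fun x hx y hy => (h.2 y hy x hx).symm⟩⟩
      loopless := ⟨fun _ h => h.1 rfl⟩ }

theorem FinGraph.v_cone (G : FinGraph) : G.cone.v = G.v + 1 := Finite.card_option

theorem FinGraph.le_e_cone (G : FinGraph) : G.e + G.v ≤ G.cone.e := by
  have h1 := two_mul_e G
  have h2 := two_mul_e G.cone
  let A : Set (G.cone.V × G.cone.V) := Prod.map some some '' adjPairs G.graph Set.univ
  let C : Set (G.cone.V × G.cone.V) := Set.range fun x : G.V => ((none : Option G.V), some x)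
  let D : Set (G.cone.V × G.cone.V) := Set.range fun x : G.V => (some x, (none : Option G.V))
  have hA : A.ncard = pairCount G.graph Set.univ :=
    Set.ncard_image_of_injective _
      ((Option.some_injective _).prodMap (Option.some_injective _))
  have hC : C.ncard = G.v := by
    refine Set.ncard_range_of_injective fun x y e => ?_
    simpa using e
  have hD : D.ncard = G.v := by
    refine Set.ncard_range_of_injective fun x y e => ?_
    simpa using e
  have hAC : Disjoint A C := by
    rw [Set.disjoint_left]
    rintro _ ⟨⟨x, y⟩, -, rfl⟩ ⟨z, e⟩
    simp at e
  have hACD : Disjoint (A ∪ C) D := by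
    rw [Set.disjoint_left]
    rintro _ (⟨⟨x, y⟩, -, rfl⟩ | ⟨w, rfl⟩) ⟨z, e⟩ <;> simp at e
  have hle : (A ∪ C ∪ D).ncard ≤ pairCount G.cone.graph Set.univ := by
    refine Set.ncard_le_ncard ?_
    rintro _ ((⟨⟨x, y⟩, h, rfl⟩ | ⟨w, rfl⟩) | ⟨w, rfl⟩)
    · refine ⟨trivial, trivial, ?_, ?_⟩
      · simpa using G.graph.ne_of_adj h.2.2
      · simpa using h.2.2
    · exact ⟨trivial, trivial, by simp, by simp⟩
    · exact ⟨trivial, trivial, by simp, by simp⟩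
  rw [Set.ncard_union_eq hACD, Set.ncard_union_eq hAC] at hle
  omega

/-- Removing from a minor of the cone the vertex whose branch set contains the apex leaves a minor of
the original graph. -/
theorem cone_mem_sparseClass {𝒜 : Set FinGraph} (hmc : MinorClosed 𝒜) {β : ℝ}
    (hβ : ∀ G ∈ 𝒜, G.density ≤ β) {G : FinGraph} (hG : G ∈ 𝒜) :
    G.cone ∈ sparseClass (1 + β) := by
  rintro M ⟨W, hW, hd, ha⟩
  have hx : ∃ x₀ : M.V, ∀ x, x ≠ x₀ → (none : Option G.V) ∉ W x := by
    by_cases h : ∃ x₀, (none : Option G.V) ∈ W x₀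
    · obtain ⟨x₀, h₀⟩ := h
      exact ⟨x₀, fun x hx hxn => Set.disjoint_left.1 (hd x x₀ hx) hxn h₀⟩
    · push Not at h
      obtain ⟨x₀⟩ := M.nonempty
      exact ⟨x₀, fun x _ => h x⟩
  obtain ⟨x₀, hx₀⟩ := hx
  have hcard := Set.ncard_add_ncard_compl ({x₀} : Set M.V)
  change _ = M.v at hcard
  rw [Set.ncard_singleton] at hcard
  have hM : 2 * M.e ≤ pairCount M.graph ({x₀}ᶜ) + 2 * ({x₀}ᶜ : Set M.V).ncard := by
    have := pairCount_union_le (G := M.graph) (A := {x₀}) (R := {x₀}ᶜ)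
      (r := ({x₀}ᶜ : Set M.V).ncard) (fun z _ => Set.ncard_le_ncard fun y hy => hy.1)
    rw [Set.union_compl_self, Set.ncard_singleton, ← two_mul_e] at this
    omega
  have hrest : (pairCount M.graph ({x₀}ᶜ) : ℝ) ≤ 2 * β * ({x₀}ᶜ : Set M.V).ncard := by
    rcases ({x₀}ᶜ : Set M.V).eq_empty_or_nonempty with he | hne
    · simp [he, pairCount, adjPairs]
    obtain ⟨g₀⟩ := G.nonempty
    have hmin : IsMinor (M.restrict _ hne) G := by
      have hnn : ∀ x : ({x₀}ᶜ : Set M.V), ∀ a ∈ W x, ∃ g, a = some g :=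
        fun x a hax => Option.ne_none_iff_exists'.1 fun e => hx₀ x x.2 (e ▸ hax)
      have hadj : ∀ g g' : G.V, G.cone.graph.Adj (some g) (some g') → G.graph.Adj g g' :=
        fun g g' h => h.2 g rfl g' rfl
      refine ⟨fun x => (fun a : Option G.V => a.getD g₀) '' W x.1, fun x => ?_, fun x y hxy => ?_,
        fun x y hxy => ?_⟩
      · refine connected_image (hW x.1) _ fun a hax b hbx hab => Or.inr ?_
        obtain ⟨g, rfl⟩ := hnn x a hax
        obtain ⟨g', rfl⟩ := hnn x b hbx
        exact hadj g g' hab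
      · rw [Set.disjoint_left]
        rintro _ ⟨a, hax, rfl⟩ ⟨b, hby, e⟩
        obtain ⟨g, rfl⟩ := hnn x a hax
        obtain ⟨g', rfl⟩ := hnn y b hby
        simp only [Option.getD_some] at e
        subst e
        exact Set.disjoint_left.1 (hd x.1 y.1 fun e => hxy (Subtype.ext e)) hax hby
      · obtain ⟨a, hax, b, hby, hab⟩ := ha x.1 y.1 hxy
        obtain ⟨g, rfl⟩ := hnn x a hax
        obtain ⟨g', rfl⟩ := hnn y b hby
        exact ⟨g, ⟨_, hax, rfl⟩, g', ⟨_, hby, rfl⟩, hadj g g' hab⟩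
    have h1 := FinGraph.density_le_iff.1 (hβ _ (hmc G hG _ hmin))
    rw [M.v_restrict] at h1
    have h2 : (2 : ℝ) * (M.restrict _ hne).e = pairCount M.graph ({x₀}ᶜ) := by
      exact_mod_cast M.two_mul_e_restrict _ hne
    linarith
  have hM' : (2 : ℝ) * M.e ≤ pairCount M.graph ({x₀}ᶜ) + 2 * ({x₀}ᶜ : Set M.V).ncard := by
    exact_mod_cast hM
  have hc' : (1 : ℝ) + ({x₀}ᶜ : Set M.V).ncard = M.v := by exact_mod_cast hcard
  rw [← hc']
  linarith

theorem B_nonneg {β : ℝ} (h : β ∈ B) : 0 ≤ β := by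
  obtain ⟨𝒜, ⟨⟨G, hG⟩, -⟩, -, hβ⟩ := h
  exact G.density_nonneg.trans (hβ.1 ⟨G, hG, rfl⟩)

theorem onePlusB_subset : onePlusB ⊆ Bt 2 := by
  rintro _ ⟨β, hβB, rfl⟩
  have h0 := B_nonneg hβB
  obtain ⟨𝒜, -, hmc, hβ⟩ := hβB
  refine mem_Bt_two (by linarith) fun b hb => ?_
  obtain ⟨_, ⟨G, hG, rfl⟩, hlt⟩ := (lt_isLUB_iff hβ).1 (by linarith : b - 1 < β)
  refine ⟨G.cone, cone_mem_sparseClass hmc (fun H hH => hβ.1 ⟨H, hH, rfl⟩) hG, ?_⟩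
  have h1 : ((G.e + G.v : ℕ) : ℝ) ≤ G.cone.e := by exact_mod_cast G.le_e_cone
  have h2 : (b - 1) * G.v < G.e := by
    by_contra! hle
    exact absurd (FinGraph.density_le_iff.2 hle) (not_le.2 hlt)
  rw [G.v_cone]
  push_cast at h1 ⊢
  linarith

/-! ### Accumulation points -/

theorem finite_image_density_of_v_le (n : ℕ) :
    (FinGraph.density '' {G | G.v ≤ n}).Finite := by
  refine (((Finset.range (n * n + 1)) ×ˢ (Finset.range (n + 1))).finite_toSet.image
    fun p => (p.1 : ℝ) / p.2).subset ?_
  rintro _ ⟨G, hG, rfl⟩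
  have h := G.e_le_sq
  have h2 : G.v * G.v ≤ n * n := Nat.mul_le_mul hG hG
  refine ⟨(G.e, G.v), ?_, rfl⟩
  have : G.v ≤ n := hG
  simp only [Finset.coe_product, Set.mem_prod, Finset.coe_range, Set.mem_Iio]
  omega

/-- The critical density of the class of minors of a single graph is attained. -/
theorem exists_isGreatest_density_minor (G : FinGraph) :
    ∃ β, IsGreatest (FinGraph.density '' {H | IsMinor H G}) β ∧ β ∈ B := by
  have hfin : (FinGraph.density '' {H | IsMinor H G}).Finite :=
    (finite_image_density_of_v_le G.v).subset (Set.image_mono fun H hH => hH.v_le)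
  obtain ⟨β, hβ, hmax⟩ := hfin.exists_maximal ⟨_, G, isMinor_refl G, rfl⟩
  have hgr : IsGreatest (FinGraph.density '' {H | IsMinor H G}) β :=
    ⟨hβ, fun x hx => (le_total x β).elim id fun h => hmax hx h⟩
  refine ⟨β, hgr, {H | IsMinor H G}, ⟨⟨G, isMinor_refl G⟩, ?_⟩,
    fun _ hH _ hK => isMinor_trans hK hH, hgr.isLUB⟩
  exact ne_univ_of_density_le fun H hH => hgr.2 ⟨H, hH, rfl⟩

theorem Bt_two_subset : Bt 2 ⊆ derivedSet B := by
  rintro β ⟨𝒜, ⟨⟨G₀, hG₀⟩, -⟩, hmc, hex, hβ⟩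
  have hup : ∀ G ∈ 𝒜, G.density ≤ β := fun G hG => hβ.1 ⟨G, hG, rfl⟩
  have he : ∀ G ∈ 𝒜, (G.e : ℝ) ≤ β * (G.v - 1) :=
    fun G hG => e_le_of_density_le hmc hex hup hG
  -- the edge is in the class, since no `2`-connected graph is a minor of it
  have hβ1 : 1 ≤ β := by
    have hK : completeFinGraph 1 ∈ 𝒜 := by
      by_contra hK
      obtain ⟨X, hX, hXe⟩ := exists_isExcludedMinor 𝒜 hK
      have h1 := (hex X hXe).1
      have h2 := hX.v_le
      have h3 : (completeFinGraph 1).v = 2 := by simp [FinGraph.v, completeFinGraph]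
      omega
    have h1 := he _ hK
    have h2 := e_completeFinGraph 1
    have h3 : (completeFinGraph 1).v = 2 := by simp [FinGraph.v, completeFinGraph]
    have h4 : (completeFinGraph 1).e = 1 := by omega
    rw [h3, h4] at h1
    norm_num at h1
    exact h1
  have hlt : ∀ G ∈ 𝒜, G.density < β := by
    intro G hG
    have h1 := he G hG
    have h2 : (0 : ℝ) < G.v := by exact_mod_cast G.v_pos
    rw [FinGraph.density, div_lt_iff₀ h2]
    linarith
  rw [mem_derivedSet, accPt_iff_nhds]
  intro U hU
  obtain ⟨ε, hε, hball⟩ := Metric.mem_nhds_iff.1 hU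
  obtain ⟨_, ⟨G, hG, rfl⟩, hG'⟩ := (lt_isLUB_iff hβ).1 (by linarith : β - ε < β)
  obtain ⟨γ, hγ, hγB⟩ := exists_isGreatest_density_minor G
  have h1 : G.density ≤ γ := hγ.2 ⟨G, isMinor_refl G, rfl⟩
  obtain ⟨⟨H, hH, rfl⟩, -⟩ := hγ
  have h2 := hlt H (hmc G hG H hH)
  refine ⟨H.density, ⟨hball ?_, hγB⟩, h2.ne⟩
  rw [Metric.mem_ball, Real.dist_eq, abs_lt]
  constructor <;> linarith

theorem Bt_subset_B (t : ℕ) : Bt t ⊆ B := fun _ ⟨𝒜, h1, h2, _, h3⟩ => ⟨𝒜, h1, h2, h3⟩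

/-- A point with a neighbourhood that contains only finitely many points of `A` is not an
accumulation point of `A`. -/
theorem notMem_derivedSet_of_finite {A : Set ℝ} {a b x : ℝ} (hx : x ∈ Set.Ioo a b)
    (hfin : (A ∩ Set.Ioo a b).Finite) : x ∉ derivedSet A := by
  intro h
  rw [mem_derivedSet] at h
  have := h.nhds_inter (isOpen_Ioo.mem_nhds hx)
  rw [Set.inter_comm] at this
  exact Set.Infinite.of_accPt this hfin

/-! ### Graphs with no denser minor -/

/-- The map that contracts the vertex set `S` to the single vertex `none`. -/
noncomputable def contractMap {V : Type*} (S : Set V) (x : V) : Option {x : V // x ∉ S} :=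
  open Classical in if h : x ∈ S then none else some ⟨x, h⟩

theorem contractMap_of_mem {V : Type*} {S : Set V} {x : V} (h : x ∈ S) : contractMap S x = none :=
  dif_pos h

theorem contractMap_of_notMem {V : Type*} {S : Set V} {x : V} (h : x ∉ S) :
    contractMap S x = some ⟨x, h⟩ :=
  dif_neg h

theorem contractMap_eq_none {V : Type*} {S : Set V} {x : V} : contractMap S x = none ↔ x ∈ S := by
  unfold contractMap
  split_ifs with h <;> simp [h]

theorem contractMap_eq_some {V : Type*} {S : Set V} {x : V} {y : {x : V // x ∉ S}} :
    contractMap S x = some y ↔ x = y := by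
  unfold contractMap
  split_ifs with h
  · simp only [false_iff]
    rintro rfl
    exact y.2 h
  · simp [Subtype.ext_iff]

/-- The graph obtained from `G` by contracting `S` to a single vertex. -/
abbrev FinGraph.contract (G : FinGraph) (S : Set G.V) : FinGraph where
  V := Option {x : G.V // x ∉ S}
  graph :=
    { Adj := fun a b => a ≠ b ∧
        ∃ x y, contractMap S x = a ∧ contractMap S y = b ∧ G.graph.Adj x y
      symm := ⟨fun _ _ ⟨h, x, y, hx, hy, hxy⟩ => ⟨h.symm, y, x, hy, hx, hxy.symm⟩⟩
      loopless := ⟨fun _ h => h.1 rfl⟩ }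

theorem FinGraph.v_contract (G : FinGraph) (S : Set G.V) :
    (G.contract S).v + S.ncard = G.v + 1 := by
  have h := Set.ncard_add_ncard_compl S
  have h2 : Nat.card {x : G.V // x ∉ S} = Sᶜ.ncard := Nat.card_coe_set_eq Sᶜ
  have h3 : (G.contract S).v = Nat.card {x : G.V // x ∉ S} + 1 := Finite.card_option
  have h4 : Nat.card G.V = G.v := rfl
  omega

theorem FinGraph.isMinor_contract (G : FinGraph) {S : Set G.V}
    (hS : (G.graph.induce S).Connected) : IsMinor (G.contract S) G := by
  refine ⟨fun a => contractMap S ⁻¹' {a}, fun a => ?_, fun a b hab => ?_, fun a b hab => ?_⟩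
  · rcases a with _ | y
    · have : contractMap S ⁻¹' {none} = S := by
        ext x
        simp [contractMap_eq_none]
      beta_reduce
      rw [this]
      exact hS
    · have : contractMap S ⁻¹' {some y} = {y.1} := by
        ext x
        simp [contractMap_eq_some]
      beta_reduce
      rw [this]
      exact connected_singleton _ _
  · rw [Set.disjoint_left]
    intro x hx hy
    exact hab (hx.symm.trans hy)
  · obtain ⟨-, x, y, hx, hy, hxy⟩ := hab
    exact ⟨x, hx, y, hy, hxy⟩

/-- If no vertex outside `S` has two neighbours in `S`, then contracting `S` loses only the edges
inside `S`. -/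
theorem FinGraph.e_le_contract (G : FinGraph) {S : Set G.V}
    (hS : ∀ u ∉ S, ∀ y ∈ S, ∀ z ∈ S, G.graph.Adj u y → G.graph.Adj u z → y = z) :
    2 * G.e ≤ pairCount G.graph S + 2 * (G.contract S).e := by
  rw [two_mul_e, two_mul_e]
  have hsub : adjPairs G.graph S ⊆ adjPairs G.graph Set.univ :=
    fun p hp => ⟨trivial, trivial, hp.2.2⟩
  have h1 := Set.ncard_sdiff_add_ncard_of_subset hsub
  have h2 : (adjPairs G.graph Set.univ \ adjPairs G.graph S).ncard ≤
      (adjPairs (G.contract S).graph Set.univ).ncard := by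
    have hout : ∀ {x y x' y'}, G.graph.Adj x y → G.graph.Adj x' y' → y ∉ S →
        contractMap S x = contractMap S x' → contractMap S y = contractMap S y' →
        x = x' ∧ y = y' := by
      intro x y x' y' hxy hxy' hy ex ey
      rw [contractMap_of_notMem hy, eq_comm, contractMap_eq_some] at ey
      simp only at ey
      subst ey
      by_cases hx : x ∈ S
      · rw [contractMap_of_mem hx, eq_comm, contractMap_eq_none] at ex
        exact ⟨hS _ hy _ hx _ ex hxy.symm hxy'.symm, rfl⟩
      · rw [contractMap_of_notMem hx, eq_comm, contractMap_eq_some] at ex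
        exact ⟨ex.symm, rfl⟩
    refine Set.ncard_le_ncard_of_injOn (Prod.map (contractMap S) (contractMap S)) ?_ ?_
    · rintro ⟨x, y⟩ ⟨⟨-, -, hxy⟩, hn⟩
      refine ⟨trivial, trivial, fun e => hn ?_, x, y, rfl, rfl, hxy⟩
      by_cases hy : y ∈ S
      · have hx : x ∈ S := contractMap_eq_none.1 (e.trans (contractMap_of_mem hy))
        exact ⟨hx, hy, hxy⟩
      · have := contractMap_eq_some.1 (e.trans (contractMap_of_notMem hy))
        exact absurd this (G.graph.ne_of_adj hxy)
    · rintro ⟨x, y⟩ ⟨⟨-, -, hxy⟩, hn⟩ ⟨x', y'⟩ ⟨⟨-, -, hxy'⟩, -⟩ e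
      obtain ⟨ex, ey⟩ := Prod.ext_iff.1 e
      by_cases hy : y ∈ S
      · have hx : x ∉ S := fun hx => hn ⟨hx, hy, hxy⟩
        obtain ⟨rfl, rfl⟩ := hout hxy.symm hxy'.symm hx ey ex
        rfl
      · obtain ⟨rfl, rfl⟩ := hout hxy hxy' hy ex ey
        rfl
  unfold pairCount
  omega

/-- All minors of `H` with fewer vertices are less dense than `H`. -/
def IsDensityMinimal (H : FinGraph) : Prop :=
  ∀ M, IsMinor M H → M.v < H.v → M.density < H.density

theorem exists_isDensityMinimal (G : FinGraph) :
    ∃ H, IsMinor H G ∧ G.density ≤ H.density ∧ IsDensityMinimal H := by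
  obtain ⟨β, ⟨⟨H₀, hH₀, hβ⟩, hmax⟩, -⟩ := exists_isGreatest_density_minor G
  let p : ℕ → Prop := fun n => ∃ H : FinGraph, IsMinor H G ∧ H.density = β ∧ H.v = n
  have hp : ∃ n, p n := ⟨_, H₀, hH₀, hβ, rfl⟩
  classical
  obtain ⟨H, hHG, hH, hn⟩ := Nat.find_spec hp
  refine ⟨H, hHG, hH ▸ hmax ⟨G, isMinor_refl G, rfl⟩, fun M hM hlt => ?_⟩
  have hMG := isMinor_trans hM hHG
  refine lt_of_le_of_ne (hH ▸ hmax ⟨M, hMG, rfl⟩) fun e => ?_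
  have := Nat.find_min' hp ⟨M, hMG, e.trans hH, rfl⟩
  omega

theorem IsDensityMinimal.pairCount_lt {H : FinGraph} (hH : IsDensityMinimal H) {S : Set H.V}
    (hS : S.Nonempty) (hlt : S.ncard < H.v) :
    (pairCount H.graph S : ℝ) < 2 * H.density * S.ncard := by
  have h := hH _ (isMinor_restrict H S hS) (by rwa [H.v_restrict])
  have h2 : (2 : ℝ) * (H.restrict S hS).e = pairCount H.graph S := by
    exact_mod_cast H.two_mul_e_restrict S hS
  have h3 : (0 : ℝ) < S.ncard := by exact_mod_cast (Set.ncard_pos).2 hS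
  have h4 : ((H.restrict S hS).e : ℝ) < H.density * S.ncard := by
    rwa [FinGraph.density, H.v_restrict, div_lt_iff₀ h3] at h
  linarith

theorem FinGraph.density_mul_v (G : FinGraph) : G.density * G.v = G.e :=
  div_mul_cancel₀ _ (by exact_mod_cast G.v_pos.ne')

theorem IsDensityMinimal.connected {H : FinGraph} (hH : IsDensityMinimal H) :
    (H.graph.induce Set.univ).Connected := by
  by_contra hc
  obtain ⟨P, Q, hP, hQ, hd, hun, hadj⟩ := exists_split Set.univ_nonempty hc
  have hcard := Set.ncard_union_eq hd
  rw [hun, Set.ncard_univ] at hcard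
  change H.v = _ at hcard
  have hPpos := (Set.ncard_pos (s := P)).2 hP
  have hQpos := (Set.ncard_pos (s := Q)).2 hQ
  have h1 := hH.pairCount_lt hP (by omega)
  have h2 := hH.pairCount_lt hQ (by omega)
  have h3 : pairCount H.graph Set.univ ≤ pairCount H.graph P + pairCount H.graph Q := by
    rw [← hun]
    apply pairCount_le_add
    rintro a (ha | ha) b (hb | hb) hab
    · exact Or.inl ⟨ha, hb⟩
    · exact absurd hab (hadj a ha b hb)
    · exact absurd hab.symm (hadj b hb a ha)
    · exact Or.inr ⟨ha, hb⟩
  rw [← two_mul_e] at h3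
  have h3' : (2 : ℝ) * H.e ≤ pairCount H.graph P + pairCount H.graph Q := by exact_mod_cast h3
  have h4 := H.density_mul_v
  rw [hcard] at h4
  push_cast at h4
  linarith

/-- Contracting a connected set `S` none of whose outside vertices has two neighbours in it loses
`|S| - 1` vertices and the edges inside `S`, so there are more than `ρ (|S| - 1)` of these. -/
theorem IsDensityMinimal.lt_pairCount {H : FinGraph} (hH : IsDensityMinimal H) {S : Set H.V}
    (hS : (H.graph.induce S).Connected) (hcard : 2 ≤ S.ncard)
    (hnb : ∀ u ∉ S, ∀ y ∈ S, ∀ z ∈ S, H.graph.Adj u y → H.graph.Adj u z → y = z) :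
    2 * H.density * (S.ncard - 1) < pairCount H.graph S := by
  have hv := H.v_contract S
  have h1 := hH _ (H.isMinor_contract hS) (by omega)
  have h2 : (0 : ℝ) < (H.contract S).v := by exact_mod_cast (H.contract S).v_pos
  rw [FinGraph.density, div_lt_iff₀ h2] at h1
  have h3 : (2 : ℝ) * H.e ≤ pairCount H.graph S + 2 * (H.contract S).e := by
    exact_mod_cast H.e_le_contract hnb
  have h4 : ((H.contract S).v : ℝ) + S.ncard = H.v + 1 := by exact_mod_cast hv
  have h5 := H.density_mul_v
  have h6 : ((H.contract S).v : ℝ) = H.v + 1 - S.ncard := by linarith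
  rw [h6] at h1
  nlinarith

/-- The growth step. The set `T` meets `S` in one vertex and satisfies `e(T) ≥ 2 |T| - 3`. As long
as `|T| ≤ k + 1` and `e(T) = 2 |T| - 3`, some vertex outside `T` has two neighbours in `T`,
as otherwise contracting `T` would not decrease the density. If it is outside `S`, then it can be
added to `T`; if it is in `S`, then it gives an additional edge between `S` and `T`. The number
`d` bounds how often `T` can still grow. -/
theorem IsDensityMinimal.exists_superset {H : FinGraph} (hH : IsDensityMinimal H) {k : ℕ}
    (hk : 1 ≤ k) (hρ : 2 - 1 / (k : ℝ) < H.density) {S : Set H.V}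
    (hS : (H.graph.induce S).Connected)
    (hSe : 2 * (2 - 1 / ((k : ℝ) + 1)) * (S.ncard - 1) ≤ pairCount H.graph S) {x : H.V}
    (d : ℕ) (T : Set H.V) (hT : (H.graph.induce T).Connected) (hxS : x ∈ S) (hxT : x ∈ T)
    (hST : ∀ y ∈ S, y ∈ T → y = x) (hcard : 2 ≤ T.ncard) (hd : k + 2 ≤ T.ncard + d)
    (hTe : 4 * T.ncard ≤ pairCount H.graph T + 6) :
    ∃ S' : Set H.V, S.ncard < S'.ncard ∧ (H.graph.induce S').Connected ∧
      2 * (2 - 1 / ((k : ℝ) + 1)) * (S'.ncard - 1) ≤ pairCount H.graph S' := by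
  have hk0 : (0 : ℝ) < k := by exact_mod_cast hk
  have hsub : (S ∩ T).Subsingleton := by
    rintro a ⟨ha, ha'⟩ b ⟨hb, hb'⟩
    rw [hST a ha ha', hST b hb hb']
  have hint : (S ∩ T).ncard = 1 := by
    have : S ∩ T = {x} := by
      ext y
      exact ⟨fun h => hST y h.1 h.2, fun h => by rw [Set.mem_singleton_iff.1 h]; exact ⟨hxS, hxT⟩⟩
    rw [this, Set.ncard_singleton]
  have hcardU := Set.ncard_union_add_ncard_inter S T
  rw [hint] at hcardU
  have hUconn : (H.graph.induce (S ∪ T)).Connected :=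
    SimpleGraph.induce_union_connected hS.preconnected hT.preconnected ⟨x, hxS, hxT⟩
  -- `S ∪ T` is dense enough if each vertex of `T` other than `x` brings enough edges
  have hdone : (2 * (2 - 1 / ((k : ℝ) + 1)) * (T.ncard - 1) + pairCount H.graph S ≤
      pairCount H.graph (S ∪ T)) → ∃ S' : Set H.V, S.ncard < S'.ncard ∧
      (H.graph.induce S').Connected ∧
      2 * (2 - 1 / ((k : ℝ) + 1)) * (S'.ncard - 1) ≤ pairCount H.graph S' := by
    intro h
    refine ⟨S ∪ T, by omega, hUconn, ?_⟩
    have : ((S ∪ T).ncard : ℝ) + 1 = S.ncard + T.ncard := by exact_mod_cast hcardU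
    have : ((S ∪ T).ncard : ℝ) - 1 = (S.ncard - 1) + (T.ncard - 1) := by linarith
    rw [this]
    linarith
  have hge := pairCount_union_ge (G := H.graph) hsub
  have hc2 : 2 - 1 / ((k : ℝ) + 1) ≤ 2 := by
    have : 0 ≤ 1 / ((k : ℝ) + 1) := by positivity
    linarith
  have hT1 : (1 : ℝ) ≤ T.ncard - 1 := by
    have : (2 : ℝ) ≤ T.ncard := by exact_mod_cast hcard
    linarith
  by_cases hfull : 4 * T.ncard ≤ pairCount H.graph T + 4
  · apply hdone
    have h1 : (4 : ℝ) * T.ncard ≤ pairCount H.graph T + 4 := by exact_mod_cast hfull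
    have h2 : (pairCount H.graph S : ℝ) + pairCount H.graph T ≤ pairCount H.graph (S ∪ T) := by
      exact_mod_cast hge
    nlinarith
  by_cases hbig : k + 2 ≤ T.ncard
  · apply hdone
    have h1 : (4 : ℝ) * T.ncard ≤ pairCount H.graph T + 6 := by exact_mod_cast hTe
    have h2 : (pairCount H.graph S : ℝ) + pairCount H.graph T ≤ pairCount H.graph (S ∪ T) := by
      exact_mod_cast hge
    have h3 : (k : ℝ) + 2 ≤ T.ncard := by exact_mod_cast hbig
    have h4 : 1 ≤ 1 / ((k : ℝ) + 1) * (T.ncard - 1) := by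
      rw [one_div, inv_mul_eq_div, one_le_div (by positivity)]
      linarith
    nlinarith
  have hu : ∃ u ∉ T, ∃ y ∈ T, ∃ z ∈ T, y ≠ z ∧ H.graph.Adj u y ∧ H.graph.Adj u z := by
    by_contra! hcon
    have h1 := hH.lt_pairCount hT hcard fun u hu y hy z hz huy huz => by
      by_contra hyz
      exact hcon u hu y hy z hz hyz huy huz
    have h2 : (pairCount H.graph T : ℝ) + 5 ≤ 4 * T.ncard := by
      have : pairCount H.graph T + 5 ≤ 4 * T.ncard := by omega
      exact_mod_cast this
    -- the number of ordered pairs is even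
    have heven : pairCount H.graph T + 6 ≤ 4 * T.ncard := by
      have := H.two_mul_e_restrict T ⟨x, hxT⟩
      omega
    have h3 : (pairCount H.graph T : ℝ) + 6 ≤ 4 * T.ncard := by exact_mod_cast heven
    have h4 : (T.ncard : ℝ) - 1 ≤ k := by
      have : T.ncard ≤ k + 1 := by omega
      have : (T.ncard : ℝ) ≤ k + 1 := by exact_mod_cast this
      linarith
    have h5 : 1 / (k : ℝ) * (T.ncard - 1) ≤ 1 := by
      rw [one_div, inv_mul_eq_div, div_le_one hk0]
      exact h4
    nlinarith
  obtain ⟨u, huT, y, hy, z, hz, hyz, huy, huz⟩ := hu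
  by_cases huS : u ∈ S
  · obtain ⟨w, hw, hwx, huw⟩ : ∃ w ∈ T, w ≠ x ∧ H.graph.Adj u w := by
      by_cases hyx : y = x
      · exact ⟨z, hz, fun h => hyz (hyx.trans h.symm), huz⟩
      · exact ⟨y, hy, hyx, huy⟩
    apply hdone
    have h0 := pairCount_union_ge_of_adj hsub huS hw huT (fun h => hwx (hST w h hw)) huw
    have h1 : (4 : ℝ) * T.ncard ≤ pairCount H.graph T + 6 := by exact_mod_cast hTe
    have h2 : (pairCount H.graph S : ℝ) + pairCount H.graph T + 2 ≤ pairCount H.graph (S ∪ T) := by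
      exact_mod_cast h0
    nlinarith
  · have hins := pairCount_insert_ge huT hy hz hyz huy huz
    have hcins := Set.ncard_insert_of_notMem huT
    cases d with
    | zero => omega
    | succ d =>
      refine hH.exists_superset hk hρ hS hSe d (insert u T)
        (connected_insert hT hy huy.symm) hxS (Or.inr hxT) ?_ (by omega) (by omega) (by omega)
      rintro w hwS (rfl | hwT)
      · exact absurd hwS huS
      · exact hST w hwS hwT

/-- A graph that is denser than all its smaller minors, and has density greater than `2 - 1 / k`,
has at least `(2 - 1 / (k + 1)) (v - 1)` edges. -/
theorem IsDensityMinimal.le_e {H : FinGraph} (hH : IsDensityMinimal H) {k : ℕ}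
    (hk : 1 ≤ k) (hρ : 2 - 1 / (k : ℝ) < H.density) :
    (2 - 1 / ((k : ℝ) + 1)) * (H.v - 1) ≤ H.e := by
  suffices h : ∀ d : ℕ, ∀ S : Set H.V, H.v ≤ S.ncard + d → (H.graph.induce S).Connected →
      2 * (2 - 1 / ((k : ℝ) + 1)) * (S.ncard - 1) ≤ pairCount H.graph S →
      (2 - 1 / ((k : ℝ) + 1)) * (H.v - 1) ≤ H.e by
    obtain ⟨x⟩ := H.nonempty
    refine h H.v {x} (by omega) (connected_singleton _ _) ?_
    rw [Set.ncard_singleton, pairCount_singleton]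
    norm_num
  intro d
  induction d with
  | zero =>
    intro S hS _ hSe
    have hle : S.ncard ≤ H.v := Set.ncard_le_card S
    have huniv : S = Set.univ := by
      rw [Set.eq_univ_iff_ncard]
      exact le_antisymm hle hS
    subst huniv
    have h1 : ((Set.univ : Set H.V).ncard : ℝ) = H.v := by
      rw [Set.ncard_univ]
      rfl
    rw [h1, ← two_mul_e] at hSe
    push_cast at hSe
    linarith
  | succ d ih =>
    intro S hS hSc hSe
    by_cases huniv : S = Set.univ
    · refine ih S ?_ hSc hSe
      rw [huniv, Set.ncard_univ]
      exact Nat.le_add_right _ _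
    -- an edge `x y` leaving `S`
    obtain ⟨x, hx, y, hy, hxy⟩ : ∃ x ∈ S, ∃ y ∉ S, H.graph.Adj x y := by
      by_contra! hcon
      obtain ⟨b, hb⟩ := (Set.ne_univ_iff_exists_notMem S).1 huniv
      obtain ⟨a, ha⟩ := Set.nonempty_coe_sort.1 hSc.nonempty
      have := const_of_connected hH.connected (· ∈ S) (fun a _ b _ hab => by
        have h1 := hcon a
        have h2 := hcon b
        have h3 := hab.symm
        simp only [eq_iff_iff]
        by_cases ha : a ∈ S <;> by_cases hb : b ∈ S <;> simp_all) (Set.mem_univ a) (Set.mem_univ b)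
      simp only [eq_iff_iff] at this
      exact hb (this.1 ha)
    have hne := H.graph.ne_of_adj hxy
    have hpair : 2 ≤ pairCount H.graph {x, y} := by
      have := pairCount_union_ge_of_adj (G := H.graph) (S := {x}) (T := {y}) (u := x) (z := y)
        (fun a ha => by
          obtain ⟨h1, h2⟩ := ha
          exact absurd (h1.symm.trans h2) hne) rfl rfl (by simpa using hne)
        (by simpa using hne.symm) hxy
      rw [Set.singleton_union] at this
      omega
    have hc2 : ({x, y} : Set H.V).ncard = 2 := Set.ncard_pair hne
    obtain ⟨S', hlt, hS'c, hS'e⟩ := hH.exists_superset hk hρ hSc hSe k {x, y}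
      (SimpleGraph.induce_pair_connected_of_adj hxy) hx (by simp)
      (fun w hw hw' => by
        rcases hw' with rfl | rfl
        · rfl
        · exact absurd hw hy) (by omega) (by omega) (by omega)
    exact ih S' (by omega) hS'c hS'e

/-! ### Small critical densities -/

/-- If every graph of the class has a minor that is at least as dense and whose density lies in the
finite set `F`
or is at most `a`, then the critical density is in `F` or at most `a`. -/
theorem mem_or_le_of_isCriticalDensity {𝒜 : Set FinGraph} (hmc : MinorClosed 𝒜) {β a : ℝ}
    (hβ : IsCriticalDensity 𝒜 β) {F : Set ℝ} (hF : F.Finite)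
    (h : ∀ G ∈ 𝒜, ∃ H, IsMinor H G ∧ G.density ≤ H.density ∧ (H.density ∈ F ∨ H.density ≤ a)) :
    β ∈ F ∨ β ≤ a := by
  by_contra! hcon
  obtain ⟨hβF, haβ⟩ := hcon
  have hfin : (insert a {f ∈ F | f < β}).Finite := (hF.subset fun f hf => hf.1).insert a
  obtain ⟨m, hm, hmax⟩ := hfin.exists_maximal ⟨a, Set.mem_insert _ _⟩
  have hmβ : m < β := by
    rcases hm with rfl | hm
    · exact haβ
    · exact hm.2
  have hle : ∀ x ∈ insert a {f ∈ F | f < β}, x ≤ m :=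
    fun x hx => (le_total x m).elim id fun h => hmax hx h
  refine absurd (hβ.2 ?_) (not_le.2 hmβ)
  rintro _ ⟨G, hG, rfl⟩
  obtain ⟨H, hHG, hGH, hH | hH⟩ := h G hG
  · refine hGH.trans (hle _ (Or.inr ⟨hH, lt_of_le_of_ne (hβ.1 ⟨H, hmc G hG H hHG, rfl⟩) ?_⟩))
    rintro rfl
    exact hβF hH
  · exact hGH.trans (hH.trans (hle _ (Or.inl rfl)))

theorem finite_B_inter_Ioo {k : ℕ} (hk : 1 ≤ k) {b : ℝ} (hb : b < 2 - 1 / ((k : ℝ) + 1)) :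
    (B ∩ Set.Ioo (2 - 1 / (k : ℝ)) b).Finite := by
  obtain ⟨N, hN⟩ := exists_nat_gt (2 / (2 - 1 / ((k : ℝ) + 1) - b))
  refine (finite_image_density_of_v_le N).subset ?_
  rintro β ⟨⟨𝒜, -, hmc, hβ⟩, haβ, hβb⟩
  refine (mem_or_le_of_isCriticalDensity hmc hβ (finite_image_density_of_v_le N)
    fun G hG => ?_).resolve_right (not_le.2 haβ)
  obtain ⟨H, hHG, hGH, hH⟩ := exists_isDensityMinimal G
  refine ⟨H, hHG, hGH, ?_⟩
  by_contra! hcon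
  have h1 := hH.le_e hk hcon.2
  have h2 : H.density ≤ β := hβ.1 ⟨H, hmc G hG H hHG, rfl⟩
  have h3 := FinGraph.density_le_iff.1 (h2.trans hβb.le)
  refine hcon.1 ⟨H, ?_, rfl⟩
  have hpos : 0 < 2 - 1 / ((k : ℝ) + 1) - b := by linarith
  have hk' : 0 ≤ 1 / ((k : ℝ) + 1) := by positivity
  rw [div_lt_iff₀ hpos] at hN
  have h4 : (H.v : ℝ) * (2 - 1 / ((k : ℝ) + 1) - b) ≤ 2 := by linarith
  have h5 : (H.v : ℝ) < N := by
    by_contra! hle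
    nlinarith
  exact_mod_cast h5.le

/-- If `14 / 11` were a critical density, then each graph of the class that is denser than its
smaller minors, and has density greater than `1`, would satisfy `3 (v - 1) / 2 ≤ e ≤ 14 v / 11`. Then
`v ≤ 6` and the density is at most `5 / 4`. -/
theorem fourteen_div_eleven_notMem_B : (14 / 11 : ℝ) ∉ B := by
  rintro ⟨𝒜, -, hmc, hβ⟩
  have key : ∀ G ∈ 𝒜, G.density ≤ 5 / 4 := by
    intro G hG
    obtain ⟨H, hHG, hGH, hH⟩ := exists_isDensityMinimal G
    refine hGH.trans ?_
    by_contra! hlt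
    have h1 := hH.le_e (k := 1) le_rfl (by norm_num; linarith)
    have h2 := FinGraph.density_le_iff.1 (hβ.1 ⟨H, hmc G hG H hHG, rfl⟩)
    have h3 : ¬ ((H.e : ℝ) ≤ 5 / 4 * H.v) := fun h => not_le.2 hlt (FinGraph.density_le_iff.2 h)
    push Not at h3
    have h1' : 3 * H.v ≤ 2 * H.e + 3 := by
      norm_num at h1
      have : (3 : ℝ) * H.v ≤ 2 * H.e + 3 := by linarith
      exact_mod_cast this
    have h2' : 11 * H.e ≤ 14 * H.v := by
      have : (11 : ℝ) * H.e ≤ 14 * H.v := by linarith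
      exact_mod_cast this
    have h3' : 5 * H.v < 4 * H.e := by
      have : (5 : ℝ) * H.v < 4 * H.e := by linarith
      exact_mod_cast this
    omega
  have := hβ.2 (by rintro _ ⟨G, hG, rfl⟩; exact key G hG)
  norm_num at this

/-! ### Critical densities up to 1 -/

/-- A critical density less than `1` is `1 - 1 / k`, where `k` is the largest order of a connected
graph in the class. -/
theorem exists_eq_of_mem_B {β : ℝ} (h : β ∈ B) (hβ1 : β < 1) :
    ∃ k : ℕ, 1 ≤ k ∧ β = 1 - 1 / (k : ℝ) := by
  obtain ⟨𝒜, ⟨⟨G₀, hG₀⟩, -⟩, hmc, hβ⟩ := h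
  have hup : ∀ G ∈ 𝒜, G.density ≤ β := fun G hG => hβ.1 ⟨G, hG, rfl⟩
  have hconn : ∀ G : FinGraph, (G.graph.induce Set.univ).Connected → G.v ≤ G.e + 1 := by
    intro G hG
    have h1 := le_pairCount_of_connected hG
    rw [← two_mul_e, Set.ncard_univ] at h1
    change 2 * G.v ≤ _ at h1
    omega
  have hlt : ∀ G ∈ 𝒜, G.e + 1 ≤ G.v := by
    intro G hG
    have h1 := FinGraph.density_le_iff.1 (hup G hG)
    have h2 : (0 : ℝ) < G.v := by exact_mod_cast G.v_pos
    have h3 : (G.e : ℝ) < G.v := by nlinarith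
    exact_mod_cast h3
  let p : ℕ → Prop := fun n => ∃ G ∈ 𝒜, (G.graph.induce Set.univ).Connected ∧ G.v = n
  obtain ⟨N, hN⟩ := exists_nat_gt (1 / (1 - β))
  have hbound : ∀ n, p n → n ≤ N := by
    rintro _ ⟨G, hG, hc, rfl⟩
    have h1 := FinGraph.density_le_iff.1 (hup G hG)
    have h2 : (G.v : ℝ) ≤ G.e + 1 := by exact_mod_cast hconn G hc
    rw [div_lt_iff₀ (by linarith)] at hN
    have h3 : (G.v : ℝ) * (1 - β) < N * (1 - β) := by linarith
    have h4 : (G.v : ℝ) < N := lt_of_mul_lt_mul_right h3 (by linarith)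
    exact_mod_cast h4.le
  have hrestr : ∀ G ∈ 𝒜, ∀ S : Set G.V, (G.graph.induce S).Connected →
      ∃ H ∈ 𝒜, (H.graph.induce Set.univ).Connected ∧ H.v = S.ncard ∧
        2 * H.e = pairCount G.graph S := by
    intro G hG S hS
    have hne : S.Nonempty := Set.nonempty_coe_sort.1 hS.nonempty
    refine ⟨G.restrict S hne, hmc G hG _ (isMinor_restrict G S hne), ?_, G.v_restrict S hne,
      G.two_mul_e_restrict S hne⟩
    exact (SimpleGraph.induceUnivIso (G.restrict S hne).graph).connected_iff.2 hS
  have hex : ∃ n, p n := by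
    obtain ⟨x⟩ := G₀.nonempty
    obtain ⟨H, hH, hc, hv, -⟩ := hrestr G₀ hG₀ {x} (connected_singleton _ _)
    exact ⟨_, H, hH, hc, rfl⟩
  obtain ⟨n₀, hn₀⟩ := hex
  classical
  have hk := Nat.findGreatest_spec (P := p) (hbound n₀ hn₀) hn₀
  have hmax : ∀ n, p n → n ≤ Nat.findGreatest p N :=
    fun n hn => Nat.le_findGreatest (hbound n hn) hn
  set k := Nat.findGreatest p N
  obtain ⟨G, hG, hc, hv⟩ := hk
  have hk1 : 1 ≤ k := hv ▸ G.v_pos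
  have hk0 : (0 : ℝ) < k := by exact_mod_cast hk1
  refine ⟨k, hk1, le_antisymm (hβ.2 ?_) ?_⟩
  · rintro _ ⟨G, hG, rfl⟩
    rw [FinGraph.density_le_iff]
    have h1 : (pairCount G.graph Set.univ : ℝ) ≤
        2 * (1 - 1 / (k : ℝ)) * (Set.univ : Set G.V).ncard := by
      refine pairCount_le_of_connected (fun S hS => ?_) _
      obtain ⟨H, hH, hHc, hHv, hHe⟩ := hrestr G hG S hS
      have h2 := hlt H hH
      have h3 : S.ncard ≤ k := hHv ▸ hmax _ ⟨H, hH, hHc, rfl⟩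
      have h4 : (pairCount G.graph S : ℝ) + 2 ≤ 2 * S.ncard := by
        have : pairCount G.graph S + 2 ≤ 2 * S.ncard := by omega
        exact_mod_cast this
      have h5 : 1 / (k : ℝ) * S.ncard ≤ 1 := by
        rw [one_div, inv_mul_eq_div, div_le_one hk0]
        exact_mod_cast h3
      linarith
    rw [← two_mul_e, Set.ncard_univ] at h1
    change _ ≤ _ * (G.v : ℝ) at h1
    push_cast at h1
    linarith
  · refine le_trans ?_ (hup G hG)
    rw [FinGraph.le_density_iff, hv]
    have h1 : (k : ℝ) ≤ G.e + 1 := by exact_mod_cast hv ▸ hconn G hc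
    rw [sub_mul, one_div, inv_mul_cancel₀ hk0.ne']
    linarith

/-- The graph with a single vertex. -/
abbrev singleGraph : FinGraph := ⟨Unit, ⊥⟩

theorem v_singleGraph : singleGraph.v = 1 := by simp [FinGraph.v]

theorem e_singleGraph : singleGraph.e = 0 := by
  have := singleGraph.e_le_sq
  rw [v_singleGraph] at this
  omega

theorem density_minor_singleGraph {H : FinGraph} (h : IsMinor H singleGraph) : H.density ≤ 0 := by
  rw [FinGraph.density_le_iff]
  have h1 := h.e_le
  rw [e_singleGraph] at h1
  have : H.e = 0 := by omega
  rw [this]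
  simp

theorem zero_mem_B : (0 : ℝ) ∈ B := by
  refine ⟨{H | IsMinor H singleGraph}, ⟨⟨singleGraph, isMinor_refl _⟩,
    ne_univ_of_density_le fun H hH => density_minor_singleGraph hH⟩,
    fun _ hH _ hK => isMinor_trans hK hH, ?_, ?_⟩
  · rintro _ ⟨H, hH, rfl⟩
    exact density_minor_singleGraph hH
  · intro b hb
    exact singleGraph.density_nonneg.trans (hb ⟨_, isMinor_refl _, rfl⟩)

theorem one_mem_B : (1 : ℝ) ∈ B :=
  Bt_subset_B 2 (onePlusB_subset ⟨0, zero_mem_B, by norm_num⟩)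

/-- The value `1 - 1 / k` is attained by the forests of order at most `k`; stars, which are copies
of an edge glued at a common end, have the largest density among them. -/
theorem one_sub_mem_B {k : ℕ} (hk : 1 ≤ k) : 1 - 1 / (k : ℝ) ∈ B := by
  have hk0 : (0 : ℝ) < k := by exact_mod_cast hk
  have hup : ∀ G ∈ {G | G ∈ sparseClass 1 ∧ G.v ≤ k}, G.density ≤ 1 - 1 / (k : ℝ) := by
    rintro G ⟨hG, hv⟩
    have h1 := hG G (isMinor_refl G)
    rw [FinGraph.density_le_iff]
    have h5 : 1 / (k : ℝ) * G.v ≤ 1 := by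
      rw [one_div, inv_mul_eq_div, div_le_one hk0]
      exact_mod_cast hv
    linarith
  have hmc := minorClosed_sparseClass 1
  have hedge : singleGraph.cone ∈ sparseClass 1 := by
    have := cone_mem_sparseClass (𝒜 := {H | IsMinor H singleGraph})
      (fun _ hH _ hK => isMinor_trans hK hH) (fun _ hH => density_minor_singleGraph hH)
      (isMinor_refl singleGraph)
    rwa [add_zero] at this
  have hstar : singleGraph.cone.glue (k - 1) none ∈ {G | G ∈ sparseClass 1 ∧ G.v ≤ k} := by
    refine ⟨glue_mem hmc
      (fun G hG => isTConnected_of_isExcludedMinor_sparseClass le_rfl hG) hedge _ _, ?_⟩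
    rw [FinGraph.v_glue, FinGraph.v_cone, v_singleGraph]
    omega
  have hdens : 1 - 1 / (k : ℝ) ≤ (singleGraph.cone.glue (k - 1) none).density := by
    rw [FinGraph.le_density_iff]
    have hv : (singleGraph.cone.glue (k - 1) none).v = k := by
      rw [FinGraph.v_glue, FinGraph.v_cone, v_singleGraph]
      omega
    have he : k ≤ (singleGraph.cone.glue (k - 1) none).e + 1 := by
      have h1 := singleGraph.cone.le_e_glue (k - 1) none
      have h2 := singleGraph.le_e_cone
      rw [e_singleGraph, v_singleGraph] at h2
      have h3 : (k - 1) * 1 ≤ (k - 1) * singleGraph.cone.e := Nat.mul_le_mul_left _ (by omega)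
      omega
    have he' : (k : ℝ) ≤ (singleGraph.cone.glue (k - 1) none).e + 1 := by exact_mod_cast he
    rw [hv, sub_mul, one_div, inv_mul_cancel₀ hk0.ne']
    linarith
  refine ⟨{G | G ∈ sparseClass 1 ∧ G.v ≤ k}, ⟨⟨_, hstar⟩, ne_univ_of_density_le hup⟩,
    fun G hG H hH => ⟨hmc G hG.1 H hH, hH.v_le.trans hG.2⟩, ?_, ?_⟩
  · rintro _ ⟨G, hG, rfl⟩
    exact hup G hG
  · intro b hb
    exact hdens.trans (hb ⟨_, hstar, rfl⟩)

theorem onePlusB_inter : onePlusB ∩ Set.Icc 1 2 = lowValues := by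
  ext x
  constructor
  · rintro ⟨⟨β, hβ, rfl⟩, -, h2⟩
    rcases (show β ≤ 1 by linarith).lt_or_eq with h | rfl
    · obtain ⟨k, hk, rfl⟩ := exists_eq_of_mem_B hβ h
      exact Or.inl ⟨k, hk, by ring⟩
    · exact Or.inr (by norm_num)
  · rintro (⟨k, hk, rfl⟩ | rfl)
    · have hk1 : (1 : ℝ) ≤ k := by exact_mod_cast hk
      have h1 : 1 / (k : ℝ) ≤ 1 := by
        rw [div_le_one (by linarith)]
        exact hk1
      have h2 : 0 ≤ 1 / (k : ℝ) := by positivity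
      exact ⟨⟨_, one_sub_mem_B hk, by ring⟩, by linarith, by linarith⟩
    · exact ⟨⟨1, one_mem_B, by norm_num⟩, by norm_num, le_rfl⟩

theorem finite_B_inter_Iio {b : ℝ} (hb : b < 1) : (B ∩ Set.Iio b).Finite := by
  obtain ⟨N, hN⟩ := exists_nat_gt (1 / (1 - b))
  refine ((Set.finite_le_nat N).image fun k : ℕ => 1 - 1 / (k : ℝ)).subset ?_
  rintro β ⟨hβ, hβb : β < b⟩
  obtain ⟨k, hk, rfl⟩ := exists_eq_of_mem_B hβ (by linarith)
  refine ⟨k, ?_, rfl⟩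
  have hk0 : (0 : ℝ) < k := by exact_mod_cast hk
  have h1 : 1 - b < 1 / (k : ℝ) := by linarith
  rw [div_lt_iff₀ (by linarith)] at hN
  rw [lt_div_iff₀ hk0] at h1
  have h2 : (k : ℝ) * (1 - b) < N * (1 - b) := by linarith
  have h3 : (k : ℝ) < N := lt_of_mul_lt_mul_right h2 (by linarith)
  exact_mod_cast h3.le

theorem derivedSet_B_inter_Ico : derivedSet B ∩ Set.Ico 0 1 = ∅ := by
  rw [Set.eq_empty_iff_forall_notMem]
  rintro x ⟨hx, -, hx1⟩
  obtain ⟨b, hxb, hb⟩ := exists_between hx1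
  refine notMem_derivedSet_of_finite (a := x - 1) (b := b) ⟨by linarith, hxb⟩ ?_ hx
  exact (finite_B_inter_Iio hb).subset fun y hy => ⟨hy.1, hy.2.2⟩

theorem derivedSet_B_inter_Icc_subset : derivedSet B ∩ Set.Icc 1 2 ⊆ lowValues := by
  rintro x ⟨hx, hx1, hx2⟩
  by_contra hlow
  have hx2' : x < 2 := lt_of_le_of_ne hx2 fun h => hlow (Or.inr h)
  have hpos : 0 < 2 - x := by linarith
  set k := ⌊1 / (2 - x)⌋₊
  have hk : 1 ≤ k := by
    rw [Nat.one_le_floor_iff, le_div_iff₀ hpos]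
    linarith
  have hk0 : (0 : ℝ) < k := by exact_mod_cast hk
  have h1 : (k : ℝ) ≤ 1 / (2 - x) := Nat.floor_le (by positivity)
  have h2 : 1 / (2 - x) < k + 1 := Nat.lt_floor_add_one _
  have h3 : 2 - 1 / (k : ℝ) ≤ x := by
    have := (le_one_div hk0 hpos).1 h1
    linarith
  have h4 : x < 2 - 1 / ((k : ℝ) + 1) := by
    have := (one_div_lt hpos (by linarith)).1 h2
    linarith
  have h5 : 2 - 1 / (k : ℝ) < x := lt_of_le_of_ne h3 fun h => hlow (Or.inl ⟨k, hk, h.symm⟩)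
  obtain ⟨b, hxb, hb⟩ := exists_between h4
  exact notMem_derivedSet_of_finite ⟨h5, hxb⟩ (finite_B_inter_Ioo hk hb) hx

/-! ### A graph with 12 vertices and 25 edges -/

/-- Adjacency in the diamond: the cycle `0123` with the chord `02`. -/
abbrev DiamondAdj (i j : Fin 4) : Prop := i ≠ j ∧ ¬ (i = 1 ∧ j = 3) ∧ ¬ (i = 3 ∧ j = 1)

/-- Adjacency in the graph obtained from the diamond by adding, for each edge of its `4`-cycle, two
adjacent vertices joined to both ends of this edge. The vertices `inr (i, b)` belong to the edge
joining `i` to `i + 1`. -/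
def DiamondK4Adj : Fin 4 ⊕ (Fin 4 × Bool) → Fin 4 ⊕ (Fin 4 × Bool) → Prop
  | .inl i, .inl j => DiamondAdj i j
  | .inl i, .inr p => i = p.1 ∨ i = p.1 + 1
  | .inr p, .inl i => i = p.1 ∨ i = p.1 + 1
  | .inr p, .inr q => p.1 = q.1 ∧ p.2 ≠ q.2

instance : DecidableRel DiamondK4Adj
  | .inl i, .inl j => inferInstanceAs (Decidable (DiamondAdj i j))
  | .inl i, .inr p => inferInstanceAs (Decidable (i = p.1 ∨ i = p.1 + 1))
  | .inr p, .inl i => inferInstanceAs (Decidable (i = p.1 ∨ i = p.1 + 1))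
  | .inr p, .inr q => inferInstanceAs (Decidable (p.1 = q.1 ∧ p.2 ≠ q.2))

/-- The diamond with a `K₄` attached along each edge of its `4`-cycle. -/
abbrev diamondK4 : FinGraph where
  V := Fin 4 ⊕ (Fin 4 × Bool)
  graph :=
    { Adj := DiamondK4Adj
      symm := ⟨fun a b => by
        rcases a with i | p <;> rcases b with j | q <;> simp only [DiamondK4Adj, DiamondAdj] <;>
          grind⟩
      loopless := ⟨fun a h => by
        rcases a with i | p <;> simp [DiamondK4Adj, DiamondAdj] at h⟩ }

theorem v_diamondK4 : diamondK4.v = 12 := by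
  simp [FinGraph.v]

theorem e_diamondK4 : diamondK4.e = 25 := by
  have h : adjPairs diamondK4.graph Set.univ =
      ((Finset.univ.filter fun p => DiamondK4Adj p.1 p.2 :
        Finset ((Fin 4 ⊕ (Fin 4 × Bool)) × (Fin 4 ⊕ (Fin 4 × Bool)))) : Set _) := by
    ext p
    simp [adjPairs]
  have h2 : (Finset.univ.filter fun p => DiamondK4Adj p.1 p.2 :
      Finset ((Fin 4 ⊕ (Fin 4 × Bool)) × (Fin 4 ⊕ (Fin 4 × Bool)))).card = 50 := by
    decide
  have h3 := two_mul_e diamondK4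
  rw [pairCount, h, Set.ncard_coe_finset, h2] at h3
  omega

theorem inl_mem_of_connected {S : Set diamondK4.V} (hS : (diamondK4.graph.induce S).Connected)
    {i j : Fin 4} {b : Bool} (hi : .inr (i, b) ∈ S) (hj : .inl j ∈ S) :
    .inl i ∈ S ∨ .inl (i + 1) ∈ S := by
  by_contra! hcon
  have := const_of_connected hS (fun a => ∃ b, a = .inr (i, b)) (fun x hx y hy hxy => by
    rcases x with k | ⟨k, b⟩ <;> rcases y with l | ⟨l, b'⟩ <;>
      simp only [DiamondK4Adj] at hxy <;> grind) hi hj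
  simp at this

theorem exists_inr_of_connected {S : Set diamondK4.V} (hS : (diamondK4.graph.induce S).Connected)
    (h : ∀ i, .inl i ∉ S) : ∃ i, ∀ a ∈ S, ∃ b, a = .inr (i, b) := by
  obtain ⟨a₀, ha₀⟩ := Set.nonempty_coe_sort.1 hS.nonempty
  rcases a₀ with k | ⟨i, b⟩
  · exact absurd ha₀ (h k)
  refine ⟨i, fun a ha => ?_⟩
  have := const_of_connected hS (fun a => ∃ b, a = .inr (i, b)) (fun x hx y hy hxy => by
    have := h
    rcases x with k | ⟨k, b⟩ <;> rcases y with l | ⟨l, b'⟩ <;>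
      simp only [DiamondK4Adj] at hxy <;> grind) ha₀ ha
  simpa using this

/-- The vertices `1` and `3` are separated by `0` and `2`. -/
theorem inl_zero_or_two_mem_of_connected {S : Set diamondK4.V}
    (hS : (diamondK4.graph.induce S).Connected) (h1 : .inl 1 ∈ S) (h3 : .inl 3 ∈ S) :
    .inl 0 ∈ S ∨ .inl 2 ∈ S := by
  by_contra! hcon
  have := const_of_connected hS
    (fun a => a = .inl 1 ∨ (∃ b, a = .inr (0, b)) ∨ ∃ b, a = .inr (1, b))
    (fun x hx y hy hxy => by
      rcases x with k | ⟨k, b⟩ <;> rcases y with l | ⟨l, b'⟩ <;>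
        simp only [DiamondK4Adj] at hxy
      · fin_cases k <;> fin_cases l <;> simp_all [DiamondAdj]
      · fin_cases k <;> fin_cases l <;> simp_all
      · fin_cases k <;> fin_cases l <;> simp_all
      · simp [hxy.1]) h1 h3
  simp at this

/-- Partition some of the vertices of the diamond into `t` parts. Then `11` times the number of
adjacent pairs of parts plus `5` times the number `s` of edges of the `4`-cycle between different
parts is at most `25 (t - 1)`, provided that a part containing `1` and `3` contains `0` or `2`.
In the encoding, `a`, `b`, `c`, `d` are the parts of `0`, `1`, `2`, `3`, with `4` for an unused
vertex, and the number of adjacent pairs is bounded by the number of all pairs, without the pair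
`{1}`, `{3}`. -/
theorem diamond_weight : ∀ a b c d : Fin 5, (b = d → b ≠ 4 → a = b ∨ c = b) →
    ∀ t s, (({a, b, c, d} : Finset (Fin 5)).erase 4).card = t →
    ((if a ≠ 4 ∧ b ≠ 4 ∧ a ≠ b then 1 else 0) + (if b ≠ 4 ∧ c ≠ 4 ∧ b ≠ c then 1 else 0) +
      (if c ≠ 4 ∧ d ≠ 4 ∧ c ≠ d then 1 else 0) + (if d ≠ 4 ∧ a ≠ 4 ∧ d ≠ a then 1 else 0)) = s →
    1 ≤ t →
    11 * (t * t) + 10 * s + 50 ≤ 61 * t +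
      (if b ≠ 4 ∧ d ≠ 4 ∧ b ≠ d ∧ a ≠ b ∧ a ≠ d ∧ c ≠ b ∧ c ≠ d then 22 else 0) := by
  intro a b c d h t s ht hs
  subst ht hs
  revert a b c d
  decide

theorem pairCount_le_of_not_adj {V : Type*} [Finite V] {G : SimpleGraph V} {T : Set V} {y z : V}
    (hy : y ∈ T) (hz : z ∈ T) (hyz : y ≠ z) (h : ¬ G.Adj y z) :
    pairCount G T + T.ncard + 2 ≤ T.ncard * T.ncard := by
  have hR := Set.ncard_sdiff_singleton_add_one hy
  have hz' : z ∈ T \ {y} := ⟨hz, hyz.symm⟩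
  have hR' := Set.ncard_sdiff_singleton_add_one hz'
  have h1 := pairCount_union_le (G := G) (A := {y}) (R := T \ {y}) (r := ((T \ {y}) \ {z}).ncard)
    (by
      rintro _ rfl
      refine Set.ncard_le_ncard fun w hw => ⟨hw.1, ?_⟩
      rintro rfl
      exact h hw.2)
  have h2 := pairCount_add_card_le_sq (G := G) (T \ {y})
  rw [Set.union_sdiff_self, Set.singleton_union, Set.insert_eq_of_mem hy, Set.ncard_singleton] at h1
  rw [← hR]
  rw [← hR'] at h2 ⊢
  nlinarith

/-- Each minor of `diamondK4` satisfies `11 e ≤ 25 (v - 1)`. The vertices whose branch set lies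
inside one of the four attached `K₄`s are counted with the edges to the other vertices: they
contribute at most `25 / 11` edges each, up to an excess of `5 / 11` for each `K₄` whose two ends
are in different branch sets. -/
theorem diamondK4_mem_sparseClass : diamondK4 ∈ sparseClass (25 / 11) := by
  rintro M ⟨W, hW, hd, ha⟩
  have huniq : ∀ {x y a}, a ∈ W x → a ∈ W y → x = y := by
    intro x y a hx hy
    by_contra hne
    exact Set.disjoint_left.1 (hd x y hne) hx hy
  have hne : ∀ x, ∃ a, a ∈ W x := fun x => Set.nonempty_coe_sort.1 (hW x).nonempty
  -- the vertices that use a vertex of the diamond, and those inside the `i`-th `K₄`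
  let T : Set M.V := {z | ∃ i, .inl i ∈ W z}
  let I : Fin 4 → Set M.V := fun i => {z | ∀ a ∈ W z, ∃ b, a = .inr (i, b)}
  let N : Fin 4 → Set M.V := fun i => {z | .inl i ∈ W z ∨ .inl (i + 1) ∈ W z}
  have hTI : ∀ z, z ∈ T ∨ ∃ i, z ∈ I i := by
    intro z
    by_cases hz : z ∈ T
    · exact Or.inl hz
    · exact Or.inr (exists_inr_of_connected (hW z) fun i hi => hz ⟨i, hi⟩)
  have hTIdisj : ∀ i z, z ∈ I i → z ∉ T := by
    rintro i z hz ⟨j, hj⟩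
    obtain ⟨b, hb⟩ := hz _ hj
    simp at hb
  have hIIdisj : ∀ i j z, z ∈ I i → z ∈ I j → i = j := by
    intro i j z hi hj
    obtain ⟨a, ha⟩ := hne z
    obtain ⟨b, rfl⟩ := hi a ha
    obtain ⟨b', hb'⟩ := hj _ ha
    simpa using congrArg (fun x : Fin 4 ⊕ (Fin 4 × Bool) => x.elim id Prod.fst) hb'
  have hIcard : ∀ i, (I i).ncard ≤ 2 := by
    intro i
    have h1 : ∀ z ∈ I i, ∃ b, .inr (i, b) ∈ W z := by
      intro z hz
      obtain ⟨a, ha⟩ := hne z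
      obtain ⟨b, rfl⟩ := hz a ha
      exact ⟨b, ha⟩
    choose! f hf using h1
    have h2 := Set.ncard_le_ncard_of_injOn (t := (Set.univ : Set Bool)) f (fun _ _ => trivial)
      fun z hz z' hz' e => huniq (hf z hz) (by rw [e]; exact hf z' hz')
    simpa using h2
  have hII : ∀ i j z z', z ∈ I i → z' ∈ I j → M.graph.Adj z z' → i = j := by
    intro i j z z' hz hz' h
    obtain ⟨a, haz, a', haz', haa⟩ := ha z z' h
    obtain ⟨b, rfl⟩ := hz a haz
    obtain ⟨b', rfl⟩ := hz' a' haz'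
    exact haa.1
  have hIN : ∀ i z z', z ∈ I i → z' ∈ T → M.graph.Adj z z' → z' ∈ N i := by
    rintro i z z' hz ⟨j, hj⟩ h
    obtain ⟨a, haz, a', haz', haa⟩ := ha z z' h
    obtain ⟨b, rfl⟩ := hz a haz
    rcases a' with k | ⟨k, b'⟩
    · rcases haa with rfl | rfl
      · exact Or.inl haz'
      · exact Or.inr haz'
    · obtain ⟨rfl, -⟩ := haa
      exact inl_mem_of_connected (hW z') haz' hj
  -- adjacent vertices of `T` use adjacent vertices of the diamond
  have hTT : ∀ z z', z ∈ T → z' ∈ T → M.graph.Adj z z' →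
      ∃ i j, .inl i ∈ W z ∧ .inl j ∈ W z' ∧ DiamondAdj i j := by
    have hcyc : ∀ i : Fin 4, DiamondAdj i (i + 1) ∧ DiamondAdj (i + 1) i := by decide
    rintro z z' ⟨k, hk⟩ ⟨l, hl⟩ h
    have hzz := M.graph.ne_of_adj h
    have hends : ∀ i, z ∈ N i → z' ∈ N i →
        ∃ i j, .inl i ∈ W z ∧ .inl j ∈ W z' ∧ DiamondAdj i j := by
      rintro i (h1 | h1) (h2 | h2)
      · exact absurd (huniq h1 h2) hzz
      · exact ⟨_, _, h1, h2, (hcyc i).1⟩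
      · exact ⟨_, _, h1, h2, (hcyc i).2⟩
      · exact absurd (huniq h1 h2) hzz
    obtain ⟨a, haz, a', haz', haa⟩ := ha z z' h
    rcases a with i | ⟨i, b⟩ <;> rcases a' with j | ⟨j, b'⟩
    · exact ⟨i, j, haz, haz', haa⟩
    · refine hends j ?_ (inl_mem_of_connected (hW z') haz' hl)
      rcases haa with rfl | rfl
      · exact Or.inl haz
      · exact Or.inr haz
    · refine hends i (inl_mem_of_connected (hW z) haz hk) ?_
      rcases haa with rfl | rfl
      · exact Or.inl haz'
      · exact Or.inr haz'
    · obtain ⟨rfl, -⟩ := haa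
      exact hends i (inl_mem_of_connected (hW z) haz hk) (inl_mem_of_connected (hW z') haz' hl)
  -- each vertex of `T` is labelled by a vertex of the diamond that it uses
  have hlab : ∀ z ∈ T, ∃ i, .inl i ∈ W z := fun _ h => h
  choose! lab hlab using hlab
  have hlabinj : ∀ z ∈ T, ∀ z' ∈ T, lab z = lab z' → z = z' :=
    fun z hz z' hz' e => huniq (hlab z hz) (by rw [e]; exact hlab z' hz')
  classical
  let σ : Fin 4 → Fin 5 := fun i =>
    if h : ∃ z, .inl i ∈ W z then (lab h.choose).castSucc else 4
  have hσ : ∀ i z, .inl i ∈ W z → σ i = (lab z).castSucc := by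
    intro i z hz
    have h : ∃ z, .inl i ∈ W z := ⟨z, hz⟩
    simp only [σ, dif_pos h]
    rw [huniq h.choose_spec hz]
  have hσ4 : ∀ i, σ i ≠ 4 → ∃ z, .inl i ∈ W z := by
    intro i hi
    by_contra h
    exact hi (dif_neg h)
  have hcast : ∀ i : Fin 4, i.castSucc ≠ (4 : Fin 5) := by decide
  have hσne : ∀ i j z z', .inl i ∈ W z → .inl j ∈ W z' → z ≠ z' → σ i ≠ σ j := by
    intro i j z z' hz hz' hzz e
    rw [hσ i z hz, hσ j z' hz'] at e
    exact hzz (hlabinj z ⟨i, hz⟩ z' ⟨j, hz'⟩ (Fin.castSucc_injective _ e))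
  have hσeq : ∀ i j z, .inl i ∈ W z → σ i = σ j → .inl j ∈ W z := by
    intro i j z hz e
    obtain ⟨z', hz'⟩ := hσ4 j (by rw [← e, hσ i z hz]; exact hcast _)
    by_cases hzz : z = z'
    · rwa [hzz]
    · exact absurd e (hσne i j z z' hz hz' hzz)
  let s : Fin 4 → ℕ := fun i => if σ i ≠ 4 ∧ σ (i + 1) ≠ 4 ∧ σ i ≠ σ (i + 1) then 1 else 0
  have hNcard : ∀ i, (N i).ncard ≤ 1 + s i := by
    intro i
    by_cases hs : σ i ≠ 4 ∧ σ (i + 1) ≠ 4 ∧ σ i ≠ σ (i + 1)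
    · have hs1 : s i = 1 := if_pos hs
      have h1 : {z | .inl i ∈ W z}.ncard ≤ 1 :=
        Set.ncard_le_one_iff_subsingleton.2 fun x hx y hy => huniq hx hy
      have h2 : {z | .inl (i + 1) ∈ W z}.ncard ≤ 1 :=
        Set.ncard_le_one_iff_subsingleton.2 fun x hx y hy => huniq hx hy
      have h3 : (N i).ncard ≤ _ := Set.ncard_union_le {z | .inl i ∈ W z} {z | .inl (i + 1) ∈ W z}
      omega
    · have hs0 : s i = 0 := if_neg hs
      rw [hs0]
      refine Set.ncard_le_one_iff_subsingleton.2 ?_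
      have key : ∀ x y, .inl i ∈ W x → .inl (i + 1) ∈ W y → x = y := by
        intro x y hx hy
        by_contra hxy
        refine hs ⟨?_, ?_, hσne _ _ x y hx hy hxy⟩
        · rw [hσ i x hx]
          exact hcast _
        · rw [hσ _ y hy]
          exact hcast _
      rintro x (hx | hx) y (hy | hy)
      · exact huniq hx hy
      · exact key x y hx hy
      · exact (key y x hy hx).symm
      · exact huniq hx hy
  have hTcard : (({σ 0, σ 1, σ 2, σ 3} : Finset (Fin 5)).erase 4).card = T.ncard := by
    rw [← Set.ncard_coe_finset]
    have h1 : Set.InjOn (fun z => (lab z).castSucc) T :=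
      fun z hz z' hz' e => hlabinj z hz z' hz' (Fin.castSucc_injective _ e)
    rw [← h1.ncard_image]
    congr 1
    have hmem : ∀ x, x ∈ ({σ 0, σ 1, σ 2, σ 3} : Finset (Fin 5)) ↔ ∃ i, σ i = x := by
      intro x
      simp only [Finset.mem_insert, Finset.mem_singleton, Fin.exists_fin_succ, Fin.succ_zero_eq_one,
        Fin.succ_one_eq_two, IsEmpty.exists_iff, or_false, eq_comm (a := x)]
      rfl
    ext x
    rw [Finset.coe_erase]
    simp only [Set.mem_sdiff, Finset.mem_coe, hmem, Set.mem_singleton_iff, Set.mem_image]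
    constructor
    · rintro ⟨⟨i, rfl⟩, hi⟩
      obtain ⟨z, hz⟩ := hσ4 i hi
      exact ⟨z, ⟨i, hz⟩, (hσ i z hz).symm⟩
    · rintro ⟨z, hz, rfl⟩
      exact ⟨⟨lab z, hσ _ z (hlab z hz)⟩, hcast _⟩
  have hweight := diamond_weight (σ 0) (σ 1) (σ 2) (σ 3) (by
    intro h13 h1
    obtain ⟨z, hz⟩ := hσ4 1 h1
    have hz3 := hσeq 1 3 z hz h13
    rcases inl_zero_or_two_mem_of_connected (hW z) hz hz3 with h | h
    · left
      rw [hσ 0 z h, hσ 1 z hz]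
    · right
      rw [hσ 2 z h, hσ 1 z hz]) T.ncard (s 0 + s 1 + s 2 + s 3) hTcard rfl
  -- the edges among the vertices of `T`
  have hTpairs : 1 ≤ T.ncard →
      11 * pairCount M.graph T + 10 * (s 0 + s 1 + s 2 + s 3) + 50 ≤ 50 * T.ncard := by
    intro ht
    have h1 := hweight ht
    split_ifs at h1 with h2
    · obtain ⟨h1', h3', h13, h01, h03, h21, h23⟩ := h2
      obtain ⟨y, hy⟩ := hσ4 1 h1'
      obtain ⟨z, hz⟩ := hσ4 3 h3'
      have hyz : y ≠ z := by
        rintro rfl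
        exact h13 (by rw [hσ 1 y hy, hσ 3 y hz])
      have hnadj : ¬ M.graph.Adj y z := by
        intro hadj
        obtain ⟨i, j, hi, hj, hij⟩ := hTT y z ⟨1, hy⟩ ⟨3, hz⟩ hadj
        have ei : σ i = σ 1 := by rw [hσ i y hi, hσ 1 y hy]
        have ej : σ j = σ 3 := by rw [hσ j z hj, hσ 3 z hz]
        have hi1 : i = 1 := by
          fin_cases i
          · exact absurd ei h01
          · rfl
          · exact absurd ei h21
          · exact absurd ei.symm h13
        have hj3 : j = 3 := by
          fin_cases j
          · exact absurd ej h03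
          · exact absurd ej h13
          · exact absurd ej h23
          · rfl
        exact hij.2.1 ⟨hi1, hj3⟩
      have h3 := pairCount_le_of_not_adj (T := T) ⟨1, hy⟩ ⟨3, hz⟩ hyz hnadj
      nlinarith
    · have h3 := pairCount_add_card_le_sq (G := M.graph) T
      nlinarith
  -- adding the vertices inside the `K₄`s
  have hsum : ∀ J : Finset (Fin 4),
      (T ∪ ⋃ i ∈ J, I i).ncard = T.ncard + ∑ i ∈ J, (I i).ncard ∧
      pairCount M.graph (T ∪ ⋃ i ∈ J, I i) + ∑ i ∈ J, (I i).ncard ≤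
        pairCount M.graph T +
          ∑ i ∈ J, (2 * ((I i).ncard * (N i).ncard) + (I i).ncard * (I i).ncard) := by
    intro J
    induction J using Finset.induction_on with
    | empty => simp
    | insert j J hj ih =>
      have hun : T ∪ ⋃ i ∈ insert j J, I i = I j ∪ (T ∪ ⋃ i ∈ J, I i) := by
        rw [Finset.set_biUnion_insert, Set.union_left_comm]
      have hdisj : Disjoint (I j) (T ∪ ⋃ i ∈ J, I i) := by
        rw [Set.disjoint_left]
        rintro z hz (hzT | hzI)
        · exact hTIdisj j z hz hzT
        · obtain ⟨i, hi, hzi⟩ := Set.mem_iUnion₂.1 hzI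
          exact hj (hIIdisj j i z hz hzi ▸ hi)
      have hle := pairCount_union_le (G := M.graph) (A := I j) (R := T ∪ ⋃ i ∈ J, I i)
        (r := (N j).ncard) (by
          intro z hz
          refine Set.ncard_le_ncard ?_
          rintro w ⟨hwT | hwI, hzw⟩
          · exact hIN j z w hz hwT hzw
          · obtain ⟨i, hi, hwi⟩ := Set.mem_iUnion₂.1 hwI
            exact absurd (hII j i z w hz hwi hzw ▸ hi) hj)
      rw [hun, Set.ncard_union_eq hdisj, ih.1, Finset.sum_insert hj, Finset.sum_insert hj]
      constructor
      · ring
      · have := ih.2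
        omega
  have hall : T ∪ ⋃ i ∈ (Finset.univ : Finset (Fin 4)), I i = Set.univ := by
    rw [Set.eq_univ_iff_forall]
    intro z
    rcases hTI z with h | ⟨i, hi⟩
    · exact Or.inl h
    · exact Or.inr (Set.mem_biUnion (Finset.mem_univ i) hi)
  obtain ⟨hv, he⟩ := hsum Finset.univ
  rw [hall, Set.ncard_univ] at hv
  change M.v = _ at hv
  rw [hall, ← two_mul_e] at he
  have hmain : 11 * M.e + 25 ≤ 25 * M.v := by
    rcases Nat.eq_zero_or_pos T.ncard with ht | ht
    · have hT0 : T = ∅ := by rwa [Set.ncard_eq_zero] at ht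
      have hN0 : ∀ i, (N i).ncard = 0 := by
        intro i
        rw [Set.ncard_eq_zero, Set.eq_empty_iff_forall_notMem]
        intro z hz
        have : z ∈ T := hz.elim (fun h => ⟨_, h⟩) fun h => ⟨_, h⟩
        rw [hT0] at this
        exact this
      have hp0 : pairCount M.graph T = 0 := by
        rw [hT0]
        simp [pairCount, adjPairs]
      have h1 : ∑ i, (2 * ((I i).ncard * (N i).ncard) + (I i).ncard * (I i).ncard) ≤
          ∑ i, 2 * (I i).ncard := by
        refine Finset.sum_le_sum fun i _ => ?_
        have := hIcard i
        rw [hN0 i]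
        nlinarith
      rw [← Finset.mul_sum] at h1
      have h2 := M.v_pos
      have h3 := M.e_le_sq
      by_cases hv1 : M.v = 1
      · rw [hv1] at h3 ⊢
        omega
      · omega
    · have h1 : 11 * ∑ i, (2 * ((I i).ncard * (N i).ncard) + (I i).ncard * (I i).ncard) ≤
          61 * ∑ i, (I i).ncard + 10 * ∑ i, s i := by
        rw [Finset.mul_sum, Finset.mul_sum, Finset.mul_sum, ← Finset.sum_add_distrib]
        refine Finset.sum_le_sum fun i _ => ?_
        have h2 := hIcard i
        have h3 := hNcard i
        have h4 : s i ≤ 1 := by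
          simp only [s]
          split_ifs <;> omega
        have h5 := Nat.mul_le_mul_left (I i).ncard h3
        generalize (I i).ncard = p at *
        generalize (N i).ncard = r at *
        generalize s i = q at *
        interval_cases p <;> omega
      rw [Fin.sum_univ_four s] at h1
      have h2 := hTpairs ht
      omega
  have h : (11 : ℝ) * M.e + 25 ≤ 25 * M.v := by exact_mod_cast hmain
  linarith

theorem twentyFive_div_eleven_mem_Bt_two : (25 / 11 : ℝ) ∈ Bt 2 := by
  refine mem_Bt_two (by norm_num) fun b hb => ⟨diamondK4, diamondK4_mem_sparseClass, ?_⟩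
  rw [v_diamondK4, e_diamondK4]
  norm_num
  linarith

theorem twentyFive_div_eleven_notMem_onePlusB : (25 / 11 : ℝ) ∉ onePlusB := by
  rintro ⟨β, hβ, h⟩
  have : β = 14 / 11 := by linarith
  exact fourteen_div_eleven_notMem_B (this ▸ hβ)

end CriticalDensity

/-- `derivedSet B` is the set `B'` of accumulation points of `B`. -/
theorem theorem5 :
    CriticalDensity.onePlusB ⊂ CriticalDensity.Bt 2 ∧
    CriticalDensity.Bt 2 ⊆ derivedSet CriticalDensity.B ∧
    CriticalDensity.Bt 2 ∩ Set.Ico 0 1 = ∅ ∧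
    derivedSet CriticalDensity.B ∩ Set.Ico 0 1 = ∅ ∧
    CriticalDensity.onePlusB ∩ Set.Icc 1 2 = CriticalDensity.lowValues ∧
    CriticalDensity.Bt 2 ∩ Set.Icc 1 2 = CriticalDensity.lowValues ∧
    derivedSet CriticalDensity.B ∩ Set.Icc 1 2 = CriticalDensity.lowValues ∧
    (25 / 11 : ℝ) ∈ CriticalDensity.Bt 2 \ CriticalDensity.onePlusB := by
  open CriticalDensity in
  have h1 := onePlusB_subset
  have h2 := Bt_two_subset
  have h3 := onePlusB_inter
  have h4 := derivedSet_B_inter_Ico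
  have h5 := derivedSet_B_inter_Icc_subset
  refine ⟨⟨h1, fun h => twentyFive_div_eleven_notMem_onePlusB (h twentyFive_div_eleven_mem_Bt_two)⟩,
    h2, ?_, h4, h3, ?_, ?_, twentyFive_div_eleven_mem_Bt_two, twentyFive_div_eleven_notMem_onePlusB⟩
  · rw [← Set.subset_empty_iff, ← h4]
    exact Set.inter_subset_inter_left _ h2
  · refine ((Set.inter_subset_inter_left _ h2).trans h5).antisymm ?_
    rw [← h3]
    exact Set.inter_subset_inter_left _ h1
  · refine h5.antisymm ?_
    rw [← h3]
    exact Set.inter_subset_inter_left _ (h1.trans h2)
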